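/- **Setting.** A tensor $A=(A^s)_{s}$ of complex $D\times D$ matrices ($D\ge 1$, $s$ ranging over a finite non-empty set of physical basis states) defines on every periodic chain of $n$ sites the MPS with wave function $\operatorname{Tr}(A^{s_1}\cdots A^{s_n})$. It is *injective* if the transfer matrix $\sum_s A^s\otimes \overline{A^s}$ has a non-degenerate dominant eigenvalue, all other eigenvalues being strictly smaller in modulus, with positive definite left and right dominant eigenvectors; it is *left-canonical* if $\sum_s (A^s)^\dagger A^s=1$. We write $\doteq$ for equality up to a phase. Let $G=\prod_{I=1}^r \mathbb Z_{N_I}$ with $N_I\ge 1$, let $a_I\in\mathbb Z$ be coprime to $N_I$, $N_{IJ}=\gcd(N_I,N_J)$, $n_{IJ}\in\mathbb Z$, and let $U_I$ be on-site unitaries with $U_I^{N_I}\doteq 1$ and $$U_IU_J=e^{2\pi i n_{IJ}/N_{IJ}}\,U_JU_I\qquad (I<J).$$ Let $L\ge1$ with $U_I^{a_I^L}\doteq U_I$. The exponential symmetries are $\mathcal U_I=\bigotimes_{j=1}^L U_I^{a_I^{j-1}}$. An MPS is *symmetric* if for all $m\ge1$ and all $I$ the MPS on $mL$ sites is an eigenstate,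 with eigenvalue a phase, of the $m$-fold periodic extension of $\mathcal U_I$. The *$\mathbb Z_N$ qudit chain* is the case $G=\mathbb Z_N\times\mathbb Z_N$ with physical space $\mathbb C^N$, generators $Z^n$ and $X$ (clock and shift, $ZX=e^{2\pi i/N}XZ$), i.e. $\mathcal U_z=\bigotimes_j Z_j^{nb^{j-1}}$ and $\mathcal U_x=\bigotimes_j X_j^{a^{j-1}}$, where $a,b$ are coprime to $N$; there $N_{IJ}=N$, $n_{IJ}=n$, $a_Ia_J=ab$. **(1) Bond class.** Let $A$ be an injective, left-canonical, symmetric MPS tensor. There are bond unitaries $v_I$ such that for all $I$ and all $j\ge1$ $$U_I^{a_I^{j-1}}\cdot A\doteq (v_I^\dagger)^{a_I^{j-1}}\,A\,v_I^{a_I^{j}} .$$ For any such $v$ and every bond $j\ge0$, the ordered products $V_j(g)=\prod_I v_I^{a_I^jg_I}$ form a projective representation of $G$, with a cocycle $\omega_j$, where $V_j(g)V_j(h)=\omega_j(g,h)V_j(gh)$. For each pair $I<J$ there is an integer $k_{IJ}$, the same for all choices of $v$, such that for all $j\ge 0$ $$\omega_j(g_I,g_J)\,\omega_j(g_J,g_I)^{-1}=v_I^{a_I^j}v_J^{a_J^j}v_I^{-a_I^j}v_J^{-a_J^j}=e^{2\pi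 i k_{IJ}(a_Ia_J)^j/N_{IJ}},$$ and $$k_{IJ}(a_Ia_J-1)\equiv n_{IJ}\pmod{N_{IJ}} .$$ In particular, on the qudit chain a bond class $k$ with $k(ab-1)\equiv n \pmod N$ is required, where $v_zv_x=e^{2\pi i k/N}v_xv_z$. **(2) Solutions.** For integers $M\ge1$, $q$, $n$ and $c=\gcd(q-1,M)$, the congruence $k(q-1)\equiv n\pmod M$ has a solution iff $c\mid n$. In that case $\frac{q-1}{c}$ has an inverse $u$ modulo $M/c$, and for every such $u$ an integer $k$ is a solution iff $k\equiv \frac nc\,u+\tau\frac Mc \pmod M$ for a (then unique) $\tau\in\{0,\dots,c-1\}$. If $c=1$, then every solution is $\not\equiv0\pmod M$ iff $n\not\equiv 0\pmod M$. (This is applied with $M=N$, $q=ab$ and with $M=N_{IJ}$, $q=a_Ia_J$.) **(3) LSM.** If $c_{IJ}=\gcd(a_Ia_J-1,N_{IJ})$ does not divide $n_{IJ}$ for some pair $I<J$ (on the qudit chain: if $c=\gcd(ab-1,N)\nmid n$), then no injective MPS, of any bond dimension and in any gauge, is symmetric. **(4) SPT-LSM.** If for some pair $I<J$ every solution $k$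 of $k(a_Ia_J-1)\equiv n_{IJ}\pmod{N_{IJ}}$ satisfies $k\not\equiv0\pmod{N_{IJ}}$ (on the qudit chain: every solution of $k(ab-1)\equiv n\pmod N$ has $k\not\equiv 0 \pmod N$), then there is an SPT-LSM obstruction: for every injective, left-canonical, symmetric MPS tensor, any $v$ as in (1) and every bond $j$, the class $[\omega_j]\in H^2(G,U(1))$ is non-trivial. If $c=1$, the qudit chain has this SPT-LSM obstruction exactly when $n\not\equiv0\pmod N$; if $c_{IJ}=1$ for all $I<J$, the general system has it exactly when $n_{IJ}\not\equiv0\pmod{N_{IJ}}$ for some pair $I<J$. -/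

import Mathlib

open scoped BigOperators Matrix

noncomputable section

namespace ModulatedMPS

open scoped ComplexOrder

variable {σ : Type*} [Fintype σ] [DecidableEq σ] {D r : ℕ}

/-- A translation-invariant MPS tensor: physical index `σ`, bond dimension `D`. -/
abbrev Tensor (σ : Type*) (D : ℕ) : Type _ := σ → Matrix (Fin D) (Fin D) ℂ

/-- The action `u · A` of an on-site operator on the physical leg of the tensor. -/
def act (u : Matrix σ σ ℂ) (A : Tensor σ D) : Tensor σ D :=
  fun s => ∑ t, u s t • A t

/-- The wave function `Tr (A^{s_1} ⋯ A^{s_n})` of the periodic MPS on `n` sites. -/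
def amplitude (A : Tensor σ D) (n : ℕ) (s : Fin n → σ) : ℂ :=
  ((List.ofFn fun j => A (s j)).prod).trace

/-- The operator `⊗_j u_j` on the `n`-site Hilbert space, acting on wave functions. -/
def chainOp {n : ℕ} (u : Fin n → Matrix σ σ ℂ) (ψ : (Fin n → σ) → ℂ) : (Fin n → σ) → ℂ :=
  fun s => ∑ t : Fin n → σ, (∏ j, u j (s j) (t j)) * ψ t

/-- The transfer matrix `∑_s A^s ⊗ (A^s)^*`, as a map acting on bond matrices from the left. -/
def transfer (A : Tensor σ D) (X : Matrix (Fin D) (Fin D) ℂ) : Matrix (Fin D) (Fin D) ℂ :=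
  ∑ s, A s * X * (A s)ᴴ

/-- The same transfer matrix acting on left eigenvectors. -/
def transferDual (A : Tensor σ D) (X : Matrix (Fin D) (Fin D) ℂ) : Matrix (Fin D) (Fin D) ℂ :=
  ∑ s, (A s)ᴴ * X * A s

/-- Injectivity: the transfer matrix has a unique (non-degenerate) dominant eigenvalue,
all other eigenvalues being strictly smaller in modulus, and its left and right dominant
eigenvectors are positive definite (full rank). No gauge is fixed. -/
def IsInjective (A : Tensor σ D) : Prop :=
  0 < D ∧ ∃ (lam : ℝ) (ρ l : Matrix (Fin D) (Fin D) ℂ),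
    0 < lam ∧ ρ.PosDef ∧ l.PosDef ∧
    transfer A ρ = (lam : ℂ) • ρ ∧ transferDual A l = (lam : ℂ) • l ∧
    ∀ (μ : ℂ) (X : Matrix (Fin D) (Fin D) ℂ), X ≠ 0 → transfer A X = μ • X →
      ‖μ‖ < lam ∨ (μ = (lam : ℂ) ∧ ∃ c : ℂ, X = c • ρ)

/-- Left-canonical normalization `∑_s (A^s)† A^s = 1`. -/
def IsLeftCanonical (A : Tensor σ D) : Prop :=
  ∑ s, (A s)ᴴ * A s = 1

/-- Equality up to a phase. -/
def EqPhase {m : Type*} (X Y : Matrix m m ℂ) : Prop :=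
  ∃ φ : Circle, X = (φ : ℂ) • Y

/-- The on-site unitary `u ^ (a ^ j)` of an exponential symmetry, `j = 0, 1, 2, …` counting the
sites from the first one (so that the first site carries `u`, the second `u ^ a`, …). -/
def siteOp (u : Matrix.unitaryGroup σ ℂ) (a : ℤ) (j : ℕ) : Matrix σ σ ℂ :=
  ((u ^ (a ^ j) : Matrix.unitaryGroup σ ℂ) : Matrix σ σ ℂ)

/-- Compatibility with periodic boundary conditions on `L` sites: `u ^ (a ^ L) = u`
up to a phase. -/
def IsPeriodic (L : ℕ) (u : Matrix.unitaryGroup σ ℂ) (a : ℤ) : Prop :=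
  EqPhase (siteOp u a L) (u : Matrix σ σ ℂ)

/-- The MPS is symmetric under all the exponential symmetries `⊗_{j<L} U_I ^ (a_I ^ j)`: for every
`m ≥ 1` the periodic MPS on `m L` sites is an eigenstate (with a phase as eigenvalue) of the
`m`-fold periodic extension of the symmetry operator. -/
def IsSymmetric (L : ℕ) (a : Fin r → ℤ) (U : Fin r → Matrix.unitaryGroup σ ℂ)
    (A : Tensor σ D) : Prop :=
  ∀ I : Fin r, ∀ m : ℕ, 0 < m → ∃ φ : Circle, ∀ s : Fin (m * L) → σ,
    chainOp (fun j : Fin (m * L) => siteOp (U I) (a I) ((j : ℕ) % L)) (amplitude A (m * L)) s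
      = (φ : ℂ) * amplitude A (m * L) s

/-- `v` is a family of bond unitaries for the symmetries: on every site `j`,
`U_I ^ (a_I ^ j) · A ≐ (v_I†) ^ (a_I ^ j) A v_I ^ (a_I ^ (j + 1))`. -/
def PushesThrough (a : Fin r → ℤ) (U : Fin r → Matrix.unitaryGroup σ ℂ) (A : Tensor σ D)
    (v : Fin r → Matrix.unitaryGroup (Fin D) ℂ) : Prop :=
  ∀ (I : Fin r) (j : ℕ), ∃ φ : Circle, ∀ s : σ,
    act (siteOp (U I) (a I) j) A s
      = (φ : ℂ) • ((siteOp (v I) (a I) j)ᴴ * A s * siteOp (v I) (a I) (j + 1))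

/-- The operators `V_j(g) = ∏_I v_I ^ (a_I ^ j g_I)` (ordered product), `g ∈ ∏_I ℤ/N_I`, by which
the symmetry group acts on bond `j`, bond `0` being the one to the left of the first site. -/
def bondOp (N : Fin r → ℕ) (a : Fin r → ℤ) (v : Fin r → Matrix.unitaryGroup (Fin D) ℂ) (j : ℕ)
    (g : ∀ I, ZMod (N I)) : Matrix.unitaryGroup (Fin D) ℂ :=
  (List.ofFn fun I => v I ^ (a I ^ j * ((g I).val : ℤ))).prod

/-- `V(g) V(h) = ω(g,h) V(g + h)` : `V` is a projective representation with cocycle `ω`. -/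
def HasCocycle {G : Type*} [Add G] (V : G → Matrix.unitaryGroup (Fin D) ℂ)
    (ω : G → G → Circle) : Prop :=
  ∀ g h : G, (V g : Matrix (Fin D) (Fin D) ℂ) * (V h : Matrix (Fin D) (Fin D) ℂ)
    = (ω g h : ℂ) • (V (g + h) : Matrix (Fin D) (Fin D) ℂ)

/-- `ω` represents the trivial class of `H²(G, U(1))`. -/
def IsCoboundary {G : Type*} [Add G] (ω : G → G → Circle) : Prop :=
  ∃ β : G → Circle, ∀ g h : G, ω g h = β g * β h * (β (g + h))⁻¹

/-- The phase `exp (2 π i k / M)`. -/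
def rootPhase (M : ℕ) (k : ℤ) : Circle :=
  Circle.exp (2 * Real.pi * (k : ℝ) / (M : ℝ))

/-- `k` is the bond class of the generators `I`, `J` for the bond unitaries `v`: on every
bond `j` the invariant `ω_j(g_I,g_J) ω_j(g_J,g_I)⁻¹`, which is the commutator phase of
`v_I ^ (a_I ^ j)` and `v_J ^ (a_J ^ j)`, equals `exp (2 π i k (a_I a_J) ^ j / M)`. For `j = 0`
this reads `v_I v_J = exp (2 π i k / M) v_J v_I`. -/
def IsBondClass (N : Fin r → ℕ) (a : Fin r → ℤ) (v : Fin r → Matrix.unitaryGroup (Fin D) ℂ)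
    (I J : Fin r) (M : ℕ) (k : ℤ) : Prop :=
  ∀ j : ℕ,
    siteOp (v I) (a I) j * siteOp (v J) (a J) j
      = (rootPhase M (k * (a I * a J) ^ j) : ℂ) •
          (siteOp (v J) (a J) j * siteOp (v I) (a I) j) ∧
    ∀ ω : (∀ K, ZMod (N K)) → (∀ K, ZMod (N K)) → Circle, HasCocycle (bondOp N a v j) ω →
      ω (Pi.single I 1) (Pi.single J 1) * (ω (Pi.single J 1) (Pi.single I 1))⁻¹
        = rootPhase M (k * (a I * a J) ^ j)

/-- `k (q - 1) ≡ n (mod M)`. -/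
def SolvesBondEquation (M : ℕ) (q n k : ℤ) : Prop :=
  k * (q - 1) ≡ n [ZMOD (M : ℤ)]

/-- LSM obstruction: no injective MPS, of any bond dimension, is symmetric. -/
def LSMObstruction (L : ℕ) (a : Fin r → ℤ) (U : Fin r → Matrix.unitaryGroup σ ℂ) : Prop :=
  ∀ (D : ℕ) (A : Tensor σ D), IsInjective A → ¬ IsSymmetric L a U A

/-- SPT-LSM obstruction (obstruction to a trivial SPT): for every symmetric injective MPS, in
left-canonical form, the projective class carried by each virtual bond is non-trivial. -/
def SPTLSMObstruction (L : ℕ) (N : Fin r → ℕ) (a : Fin r → ℤ)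
    (U : Fin r → Matrix.unitaryGroup σ ℂ) : Prop :=
  ∀ (D : ℕ) (A : Tensor σ D), IsInjective A → IsLeftCanonical A → IsSymmetric L a U A →
    ∀ v : Fin r → Matrix.unitaryGroup (Fin D) ℂ, PushesThrough a U A v →
      ∀ (j : ℕ) (ω : (∀ K, ZMod (N K)) → (∀ K, ZMod (N K)) → Circle),
        HasCocycle (bondOp N a v j) ω → ¬ IsCoboundary ω

/-- The shift matrix `X |t⟩ = |t + 1⟩` of an `N`-level qudit. -/
def shiftMatrix (N : ℕ) : Matrix (ZMod N) (ZMod N) ℂ :=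
  Matrix.of fun s t => if s = t + 1 then 1 else 0

/-- The clock matrix `Z |s⟩ = exp (2 π i s / N) |s⟩` of an `N`-level qudit. -/
def clockMatrix (N : ℕ) : Matrix (ZMod N) (ZMod N) ℂ :=
  Matrix.diagonal fun s => (rootPhase N (s.val : ℤ) : ℂ)

theorem shiftMatrix_mem (N : ℕ) [NeZero N] :
    shiftMatrix N ∈ Matrix.unitaryGroup (ZMod N) ℂ := by
  rw [Matrix.mem_unitaryGroup_iff]
  ext s t
  simp only [shiftMatrix, Matrix.star_eq_conjTranspose, Matrix.mul_apply, Matrix.of_apply,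
    Matrix.conjTranspose_apply]
  rw [Finset.sum_eq_single (s - 1)]
  · by_cases h : s = t
    · simp [h, Matrix.one_apply]
    · simp [h, Ne.symm h]
  · intro x _ hx
    have : s ≠ x + 1 := fun h => hx (by rw [h]; ring)
    simp [this]
  · simp

theorem clockMatrix_mem (N : ℕ) [NeZero N] :
    clockMatrix N ∈ Matrix.unitaryGroup (ZMod N) ℂ := by
  rw [Matrix.mem_unitaryGroup_iff, Matrix.star_eq_conjTranspose, clockMatrix,
    Matrix.diagonal_conjTranspose, Matrix.diagonal_mul_diagonal, ← Matrix.diagonal_one]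
  congr 1
  ext s
  have h : ‖(rootPhase N (s.val : ℤ) : ℂ)‖ = 1 := Circle.norm_coe _
  simp only [Pi.star_apply, RCLike.star_def, Complex.mul_conj, Complex.normSq_eq_norm_sq, h]
  simp

/-- The shift as a unitary. -/
def shift (N : ℕ) [NeZero N] : Matrix.unitaryGroup (ZMod N) ℂ := ⟨shiftMatrix N, shiftMatrix_mem N⟩

/-- The clock as a unitary. -/
def clock (N : ℕ) [NeZero N] : Matrix.unitaryGroup (ZMod N) ℂ := ⟨clockMatrix N, clockMatrix_mem N⟩

/-- The two on-site generators of the qudit chain: index `0` is `Z ^ n`, index `1` is `X`. -/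
def quditGen (N : ℕ) [NeZero N] (n : ℤ) : Fin 2 → Matrix.unitaryGroup (ZMod N) ℂ :=
  ![clock N ^ n, shift N]

end ModulatedMPS

end

open ModulatedMPS

/-!
Over one period of an exponential symmetry the transfer matrix of `A` against `U · A` has an
eigenvalue of modulus one, because the overlap of the MPS with its image under the symmetry does not
decay. The left-canonical condition makes the weight `tr (Y ρ Y†)` monotone along the chain, hence
constant on a corresponding eigenvector, and equality turns that eigenvector into a sequence of bond
unitaries `X_j` with `X_j (u_j · A) = A X_{j+1}`.

Modulo phases the triples `(u, v, w)` with `v (u · A) = A w` form a group. By injectivity of `A` a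
sequence of on-site unitaries determines the classes of its bond unitaries, which therefore inherit
all relations between the symmetries: `X_j ≐ X_0 ^ (a ^ j)`, the orders of the generators, and their
commutation. The commutators, taken in the group of triples before phases are forgotten, give
`exp (2πi n/M) exp (2πi k/M) = exp (2πi k a b/M)`, which is the congruence `k (ab - 1) ≡ n`.

A trivial class on bond `j` means `M ∣ k (ab) ^ j`, hence `M ∣ n (ab) ^ j`; periodicity gives
`n (ab) ^ L ≡ n` and so `M ∣ n`. Conversely, if all `n_{IJ}` vanish then the generators commute, and
a common eigenvector defines a symmetric product state.
-/

namespace ModulatedMPS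

open scoped ComplexOrder Matrix Kronecker commutatorElement
open Filter Topology

section MatrixPowers

variable {n : Type*} [Fintype n] [DecidableEq n]

theorem tendsto_pow_zero_of_spectralRadius_lt_one {R : Type*} [NormedRing R] [NormedAlgebra ℂ R]
    [CompleteSpace R] {x : R} (hx : spectralRadius ℂ x < 1) :
    Tendsto (fun k : ℕ => x ^ k) atTop (𝓝 0) := by
  obtain ⟨r, hxr, hr⟩ := ENNReal.lt_iff_exists_nnreal_btwn.1 hx
  have hbound : ∀ᶠ k : ℕ in atTop, ‖x ^ k‖ ≤ (r : ℝ) ^ k := by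
    filter_upwards [(spectrum.pow_nnnorm_pow_one_div_tendsto_nhds_spectralRadius
      x).eventually_lt_const hxr, eventually_gt_atTop 0] with k hk hk0
    have hk' := ENNReal.rpow_le_rpow hk.le k.cast_nonneg
    rw [← ENNReal.rpow_mul, one_div, inv_mul_cancel₀ (by positivity), ENNReal.rpow_one,
      ENNReal.rpow_natCast] at hk'
    exact_mod_cast hk'
  exact squeeze_zero_norm' hbound
    (tendsto_pow_atTop_nhds_zero_of_lt_one r.2 (by exact_mod_cast hr))

theorem exists_mulVec_eq_smul_of_mem_spectrum {K : Type*} [Field K] {M : Matrix n n K} {μ : K}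
    (hμ : μ ∈ spectrum K M) : ∃ x : n → K, x ≠ 0 ∧ M *ᵥ x = μ • x := by
  rw [← Matrix.spectrum_toLin', ← Module.End.hasEigenvalue_iff_mem_spectrum] at hμ
  obtain ⟨x, hx⟩ := hμ.exists_hasEigenvector
  exact ⟨x, hx.2, by simpa using hx.apply_eq_smul⟩

attribute [local instance] Matrix.linftyOpNormedRing Matrix.linftyOpNormedAlgebra in
theorem tendsto_pow_zero_of_norm_eigenvalue_lt_one (M : Matrix n n ℂ)
    (h : ∀ (μ : ℂ) (x : n → ℂ), x ≠ 0 → M *ᵥ x = μ • x → ‖μ‖ < 1) :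
    Tendsto (fun k : ℕ => M ^ k) atTop (𝓝 0) := by
  cases isEmpty_or_nonempty n
  · exact tendsto_const_nhds.congr fun k => Subsingleton.elim _ _
  refine tendsto_pow_zero_of_spectralRadius_lt_one ?_
  obtain ⟨μ, hμ, hμM⟩ := spectrum.exists_nnnorm_eq_spectralRadius M
  obtain ⟨x, hx, hMx⟩ := exists_mulVec_eq_smul_of_mem_spectrum hμ
  rw [← hμM]
  exact_mod_cast h μ x hx hMx

theorem exists_vecMul_eq_smul_of_not_tendsto_trace (M : Matrix n n ℂ)
    (h : ¬ Tendsto (fun k : ℕ => (M ^ k).trace) atTop (𝓝 0)) :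
    ∃ (μ : ℂ) (x : n → ℂ), x ≠ 0 ∧ x ᵥ* M = μ • x ∧ 1 ≤ ‖μ‖ := by
  by_contra! hlt
  have hpow : Tendsto (fun k : ℕ => Mᵀ ^ k) atTop (𝓝 0) :=
    tendsto_pow_zero_of_norm_eigenvalue_lt_one Mᵀ fun μ x hx hμ =>
      hlt μ x hx (by rwa [Matrix.mulVec_transpose] at hμ)
  have htrace := (continuous_id.matrix_trace.tendsto (0 : Matrix n n ℂ)).comp hpow
  exact h (by simpa [Function.comp_def, ← Matrix.transpose_pow] using htrace)

theorem sub_pow_succ_of_isIdempotentElem {R : Type*} [Ring R] {e p : R} (hep : e * p = p)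
    (hpe : p * e = p) (hp : IsIdempotentElem p) (k : ℕ) :
    (e - p) ^ (k + 1) = e ^ (k + 1) - p := by
  have hpow : ∀ k : ℕ, e ^ k * p = p := fun k => by
    induction k with
    | zero => rw [pow_zero, one_mul]
    | succ k ih => rw [pow_succ, mul_assoc, hep, ih]
  induction k with
  | zero => simp only [zero_add, pow_one]
  | succ k ih =>
    rw [pow_succ, ih, sub_mul, mul_sub, mul_sub, hpow, hpe, hp.eq, ← pow_succ, sub_self, sub_zero]

theorem tendsto_pow_vecMulVec_of_simple_eigenvalue_one (M : Matrix n n ℂ) {x y : n → ℂ}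
    (hx : M *ᵥ x = x) (hy : y ᵥ* M = y) (hyx : y ⬝ᵥ x = 1)
    (h : ∀ (μ : ℂ) (z : n → ℂ), z ≠ 0 → M *ᵥ z = μ • z → ‖μ‖ < 1 ∨ ∃ c : ℂ, z = c • x) :
    Tendsto (fun k : ℕ => M ^ k) atTop (𝓝 (Matrix.vecMulVec x y)) := by
  set P := Matrix.vecMulVec x y with hP
  have hMP : M * P = P := by rw [hP, Matrix.mul_vecMulVec, hx]
  have hPM : P * M = P := by rw [hP, Matrix.vecMulVec_mul, hy]
  have hPP : IsIdempotentElem P := by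
    rw [IsIdempotentElem, hP, Matrix.vecMulVec_mul_vecMulVec, hyx, one_smul]
  have hPx : P *ᵥ x = x := by rw [hP, Matrix.vecMulVec_mulVec, hyx, MulOpposite.op_one, one_smul]
  have hsub : Tendsto (fun k : ℕ => (M - P) ^ k) atTop (𝓝 0) := by
    refine tendsto_pow_zero_of_norm_eigenvalue_lt_one _ fun μ z hz hμ => ?_
    rcases eq_or_ne μ 0 with rfl | hμ0
    · simp
    have hPz : P *ᵥ z = 0 := by
      have : μ • (P *ᵥ z) = 0 := by
        rw [← Matrix.mulVec_smul, ← hμ, Matrix.mulVec_mulVec, mul_sub, hPM, hPP.eq, sub_self,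
          Matrix.zero_mulVec]
      exact (smul_eq_zero.1 this).resolve_left hμ0
    rw [Matrix.sub_mulVec, hPz, sub_zero] at hμ
    refine (h μ z hz hμ).resolve_right ?_
    rintro ⟨c, rfl⟩
    exact hz (by rwa [Matrix.mulVec_smul, hPx] at hPz)
  have hadd := ((tendsto_add_atTop_iff_nat 1).2 hsub).add_const P
  simp only [sub_pow_succ_of_isIdempotentElem hMP hPM hPP, sub_add_cancel, zero_add] at hadd
  exact (tendsto_add_atTop_iff_nat 1).1 hadd

end MatrixPowers

section Transfer

variable {σ : Type*} [Fintype σ] {D D' : ℕ}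

/-- The mixed transfer matrix `∑_s (A^s)^* ⊗ B^s` of two tensors. -/
noncomputable def mixedTransfer (A : Tensor σ D) (B : Tensor σ D') :
    Matrix (Fin D × Fin D') (Fin D × Fin D') ℂ :=
  ∑ s, (A s).map (starRingEnd ℂ) ⊗ₖ B s

/-- The mixed transfer matrix as a map acting on left eigenvectors. -/
noncomputable def pull (A : Tensor σ D) (B : Tensor σ D') (X : Matrix (Fin D) (Fin D') ℂ) :
    Matrix (Fin D) (Fin D') ℂ :=
  ∑ s, (A s)ᴴ * X * B s

theorem transferDual_eq_pull (A : Tensor σ D) (X : Matrix (Fin D) (Fin D) ℂ) :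
    transferDual A X = pull A A X :=
  rfl

theorem mixedTransfer_mulVec_vec (A : Tensor σ D) (B : Tensor σ D')
    (X : Matrix (Fin D') (Fin D) ℂ) :
    mixedTransfer A B *ᵥ X.vec = (∑ s, B s * X * (A s)ᴴ).vec := by
  rw [mixedTransfer, Matrix.sum_mulVec, Matrix.vec_sum]
  exact Finset.sum_congr rfl fun s _ => Matrix.kronecker_mulVec_vec ..

theorem vec_vecMul_mixedTransfer (A : Tensor σ D) (B : Tensor σ D')
    (X : Matrix (Fin D) (Fin D') ℂ) :
    Xᵀ.vec ᵥ* mixedTransfer A B = (pull A B X)ᵀ.vec := by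
  rw [mixedTransfer, pull, Matrix.vecMul_sum, Matrix.transpose_sum, Matrix.vec_sum]
  refine Finset.sum_congr rfl fun s _ => ?_
  rw [Matrix.vec_vecMul_kronecker, Matrix.transpose_mul, Matrix.transpose_mul, ← Matrix.mul_assoc]
  rfl

theorem vec_vecMul_mixedTransfer_pow (A : Tensor σ D) (X : Matrix (Fin D) (Fin D) ℂ) (k : ℕ) :
    Xᵀ.vec ᵥ* mixedTransfer A A ^ k = ((transferDual A)^[k] X)ᵀ.vec := by
  induction k generalizing X with
  | zero => simp
  | succ k ih =>
    rw [pow_succ', ← Matrix.vecMul_vecMul, vec_vecMul_mixedTransfer, Function.iterate_succ_apply]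
    exact ih _

theorem trace_transfer_mul (A : Tensor σ D) (X Y : Matrix (Fin D) (Fin D) ℂ) :
    (transfer A X * Y).trace = (X * transferDual A Y).trace := by
  simp only [transfer, transferDual, Finset.sum_mul, Finset.mul_sum, Matrix.trace_sum]
  refine Finset.sum_congr rfl fun s _ => ?_
  rw [mul_assoc, mul_assoc, Matrix.trace_mul_comm]
  simp only [mul_assoc]

theorem transfer_smul (A : Tensor σ D) (c : ℂ) (X : Matrix (Fin D) (Fin D) ℂ) :
    transfer A (c • X) = c • transfer A X := by
  simp only [transfer, mul_smul_comm, smul_mul_assoc, Finset.smul_sum]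

theorem pull_smul_left (A : Tensor σ D) (B : Tensor σ D') (c : ℂ) (X : Matrix (Fin D) (Fin D') ℂ) :
    pull A B (c • X) = c • pull A B X := by
  simp only [pull, Matrix.mul_smul, Matrix.smul_mul, Finset.smul_sum]

theorem pull_smul_right (A : Tensor σ D) (B : Tensor σ D') (c : ℂ)
    (X : Matrix (Fin D) (Fin D') ℂ) : pull A (c • B) X = c • pull A B X := by
  simp only [pull, Pi.smul_apply, Matrix.mul_smul, Finset.smul_sum]

end Transfer

section Chain

variable {σ : Type*} [Fintype σ] {D D' n : ℕ}

theorem list_prod_ofFn_sum {R : Type*} [Semiring R] (f : Fin n → σ → R) :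
    (List.ofFn fun j => ∑ t, f j t).prod =
      ∑ t : Fin n → σ, (List.ofFn fun j => f j (t j)).prod := by
  simpa using (MultilinearMap.mkPiAlgebraFin ℕ n R).map_sum f

theorem list_prod_ofFn_smul {R A : Type*} [CommSemiring R] [Semiring A] [Algebra R A]
    (c : Fin n → R) (f : Fin n → A) :
    (List.ofFn fun j => c j • f j).prod = (∏ j, c j) • (List.ofFn f).prod := by
  simpa using (MultilinearMap.mkPiAlgebraFin R n A).map_smul_univ c f

theorem list_prod_ofFn_kronecker {m m' R : Type*} [Fintype m] [DecidableEq m] [Fintype m']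
    [DecidableEq m'] [CommSemiring R] (P : Fin n → Matrix m m R) (Q : Fin n → Matrix m' m' R) :
    (List.ofFn fun j => P j ⊗ₖ Q j).prod = (List.ofFn P).prod ⊗ₖ (List.ofFn Q).prod := by
  induction n with
  | zero => simp
  | succ n ih => simp only [List.ofFn_succ, List.prod_cons, ih, Matrix.mul_kronecker_mul]

theorem list_prod_ofFn_mod {M : Type*} [Monoid M] (m L : ℕ) (f : ℕ → M) :
    (List.ofFn fun j : Fin (m * L) => f ((j : ℕ) % L)).prod
      = (List.ofFn fun j : Fin L => f j).prod ^ m := by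
  have hmod : ∀ (i : Fin m) (j : Fin L), f (((i : ℕ) * L + j) % L) = f j := fun i j => by
    rw [mul_comm, Nat.mul_add_mod, Nat.mod_eq_of_lt j.2]
  rw [List.ofFn_mul]
  simp only [hmod]
  rw [List.prod_flatten, List.map_ofFn]
  simp [Function.comp_def, List.ofFn_const]

theorem chainOp_amplitude (u : Fin n → Matrix σ σ ℂ) (A : Tensor σ D) (s : Fin n → σ) :
    chainOp u (amplitude A n) s = (List.ofFn fun j => act (u j) A (s j)).prod.trace := by
  simp only [act, chainOp, amplitude, list_prod_ofFn_sum, list_prod_ofFn_smul, Matrix.trace_sum,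
    Matrix.trace_smul, smul_eq_mul]

theorem sum_conj_amplitude_mul_trace (A : Tensor σ D) (B : Fin n → Tensor σ D') :
    ∑ s : Fin n → σ, starRingEnd ℂ (amplitude A n s) * (List.ofFn fun j => B j (s j)).prod.trace
      = (List.ofFn fun j => mixedTransfer A (B j)).prod.trace := by
  simp only [mixedTransfer, list_prod_ofFn_sum, list_prod_ofFn_kronecker, Matrix.trace_sum,
    Matrix.trace_kronecker, amplitude]
  refine Finset.sum_congr rfl fun s _ => congrArg (· * _) ?_
  rw [AddMonoidHom.map_trace]
  congr 1
  exact (map_list_prod (starRingEnd ℂ).mapMatrix _).trans (by rw [List.map_ofFn]; rfl)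

end Chain

section UnitaryAction

variable {σ : Type*} [Fintype σ] {D : ℕ}

theorem act_smul_left (c : ℂ) (u : Matrix σ σ ℂ) (A : Tensor σ D) :
    act (c • u) A = c • act u A := by
  funext s
  simp only [act, Matrix.smul_apply, Pi.smul_apply, smul_eq_mul, mul_smul, Finset.smul_sum]

variable [DecidableEq σ]

theorem sum_unitary_smul {V : Type*} [AddCommGroup V] [Module ℂ V]
    (u : Matrix.unitaryGroup σ ℂ) (F : σ → σ → V) :
    ∑ s, ∑ t, ∑ t', ((u : Matrix σ σ ℂ) s t * star ((u : Matrix σ σ ℂ) s t')) • F t t'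
      = ∑ t, F t t := by
  have horth : ∀ t t', ∑ s, (u : Matrix σ σ ℂ) s t * star ((u : Matrix σ σ ℂ) s t')
      = if t' = t then 1 else 0 := fun t t' => by
    rw [← Matrix.one_apply, ← Matrix.UnitaryGroup.star_mul_self u, Matrix.mul_apply]
    exact Finset.sum_congr rfl fun s _ => mul_comm _ _
  rw [Finset.sum_comm]
  refine Finset.sum_congr rfl fun t _ => ?_
  rw [Finset.sum_comm]
  simp_rw [← Finset.sum_smul, horth]
  simp only [ite_smul, one_smul, zero_smul, Finset.sum_ite_eq', Finset.mem_univ, if_true]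

theorem transfer_act (u : Matrix.unitaryGroup σ ℂ) (A : Tensor σ D)
    (X : Matrix (Fin D) (Fin D) ℂ) : transfer (act u A) X = transfer A X := by
  rw [transfer, transfer, ← sum_unitary_smul u fun t t' => A t * X * (A t')ᴴ]
  refine Finset.sum_congr rfl fun s _ => ?_
  simp only [act, Matrix.conjTranspose_sum, Finset.sum_mul, Finset.mul_sum,
    Matrix.conjTranspose_smul, smul_mul_assoc, mul_smul_comm, Finset.smul_sum, smul_smul]
  rw [Finset.sum_comm]
  simp only [mul_comm]

theorem transferDual_act (u : Matrix.unitaryGroup σ ℂ) (A : Tensor σ D)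
    (X : Matrix (Fin D) (Fin D) ℂ) : transferDual (act u A) X = transferDual A X := by
  rw [transferDual, transferDual, ← sum_unitary_smul u fun t t' => (A t')ᴴ * X * A t]
  refine Finset.sum_congr rfl fun s _ => ?_
  simp only [act, Matrix.conjTranspose_sum, Finset.sum_mul, Finset.mul_sum,
    Matrix.conjTranspose_smul, smul_mul_assoc, mul_smul_comm, Finset.smul_sum, smul_smul]

end UnitaryAction

section StationaryState

variable {σ : Type*} [Fintype σ] {D : ℕ} {A : Tensor σ D} {ρ : Matrix (Fin D) (Fin D) ℂ}

/-- `ρ` is the stationary state of the left-canonical injective tensor `A`, normalised to trace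
one. -/
structure IsStationary (A : Tensor σ D) (ρ : Matrix (Fin D) (Fin D) ℂ) : Prop where
  leftCanonical : IsLeftCanonical A
  posDef : ρ.PosDef
  fixed : transfer A ρ = ρ
  trace_eq_one : ρ.trace = 1
  spectral : ∀ (μ : ℂ) (X : Matrix (Fin D) (Fin D) ℂ), X ≠ 0 → transfer A X = μ • X →
    ‖μ‖ < 1 ∨ ∃ c : ℂ, X = c • ρ

theorem IsLeftCanonical.transferDual_one (hA : IsLeftCanonical A) : transferDual A 1 = 1 := by
  simpa only [transferDual, mul_one, IsLeftCanonical] using hA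

theorem IsLeftCanonical.trace_transfer (hA : IsLeftCanonical A) (X : Matrix (Fin D) (Fin D) ℂ) :
    (transfer A X).trace = X.trace := by
  simpa [hA.transferDual_one] using trace_transfer_mul A X 1

theorem exists_isStationary (hinj : IsInjective A) (hA : IsLeftCanonical A) :
    ∃ ρ, IsStationary A ρ := by
  obtain ⟨hD, lam, ρ, -, -, hρ, -, hfixed, -, hspec⟩ := hinj
  have : Nonempty (Fin D) := ⟨⟨0, hD⟩⟩
  have htr : 0 < ρ.trace := hρ.trace_pos
  obtain rfl : lam = 1 := by
    have h := hA.trace_transfer ρ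
    rw [hfixed, Matrix.trace_smul, smul_eq_mul, mul_eq_right₀ htr.ne'] at h
    exact_mod_cast h
  rw [Complex.ofReal_one, one_smul] at hfixed
  refine ⟨ρ.trace⁻¹ • ρ, hA, hρ.smul (inv_pos.2 htr), by rw [transfer_smul, hfixed], ?_,
    fun μ X hX hμ => (hspec μ X hX hμ).imp_right ?_⟩
  · rw [Matrix.trace_smul, smul_eq_mul, inv_mul_cancel₀ htr.ne']
  · rintro ⟨-, c, rfl⟩
    exact ⟨c * ρ.trace, by rw [smul_smul, mul_assoc, mul_inv_cancel₀ htr.ne', mul_one]⟩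

namespace IsStationary

theorem nonempty (h : IsStationary A ρ) : Nonempty (Fin D) := by
  by_contra hempty
  rw [not_nonempty_iff] at hempty
  simpa [Matrix.trace] using h.trace_eq_one

theorem exists_ne_zero (h : IsStationary A ρ) : ∃ s, A s ≠ 0 := by
  by_contra! hzero
  have := h.nonempty
  simpa [IsLeftCanonical, hzero] using h.leftCanonical

theorem tendsto_mixedTransfer_pow (h : IsStationary A ρ) :
    Tendsto (fun k : ℕ => mixedTransfer A A ^ k) atTop
      (𝓝 (Matrix.vecMulVec ρ.vec (1 : Matrix (Fin D) (Fin D) ℂ).vec)) := by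
  refine tendsto_pow_vecMulVec_of_simple_eigenvalue_one _ ?_ ?_ ?_ fun μ z hz hμ => ?_
  · exact (mixedTransfer_mulVec_vec A A ρ).trans (congrArg _ h.fixed)
  · have := vec_vecMul_mixedTransfer A A 1
    rwa [← transferDual_eq_pull, h.leftCanonical.transferDual_one, Matrix.transpose_one] at this
  · rw [Matrix.vec_dotProduct_vec, Matrix.transpose_one, one_mul, h.trace_eq_one]
  · obtain ⟨X, rfl⟩ := Matrix.vec_bijective.2 z
    rw [mixedTransfer_mulVec_vec, ← Matrix.vec_smul, Matrix.vec_inj] at hμ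
    exact (h.spectral μ X (by simpa using hz) hμ).imp_right
      fun ⟨c, hc⟩ => ⟨c, by rw [hc, Matrix.vec_smul]⟩

theorem tendsto_trace_mixedTransfer_pow (h : IsStationary A ρ) :
    Tendsto (fun k : ℕ => (mixedTransfer A A ^ k).trace) atTop (𝓝 1) := by
  have hlim := (continuous_id.matrix_trace.tendsto _).comp h.tendsto_mixedTransfer_pow
  simpa [Function.comp_def, Matrix.trace_vecMulVec, Matrix.vec_dotProduct_vec, h.trace_eq_one]
    using hlim

theorem tendsto_transferDual_iterate (h : IsStationary A ρ) (Y : Matrix (Fin D) (Fin D) ℂ) :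
    Tendsto (fun k : ℕ => (transferDual A)^[k] Y) atTop (𝓝 ((Y * ρ).trace • 1)) := by
  have hlim := ((continuous_const.matrix_vecMul continuous_id :
    Continuous fun M : Matrix (Fin D × Fin D) (Fin D × Fin D) ℂ => Yᵀ.vec ᵥ* M).tendsto _).comp
    h.tendsto_mixedTransfer_pow
  have hval : Yᵀ.vec ᵥ* Matrix.vecMulVec ρ.vec (1 : Matrix (Fin D) (Fin D) ℂ).vec
      = ((Y * ρ).trace • (1 : Matrix (Fin D) (Fin D) ℂ))ᵀ.vec := by
    rw [Matrix.vecMul_vecMulVec, Matrix.vec_dotProduct_vec, Matrix.transpose_transpose,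
      Matrix.transpose_smul, Matrix.transpose_one, Matrix.vec_smul]
  simp only [Function.comp_def, vec_vecMul_mixedTransfer_pow, hval] at hlim
  rw [tendsto_pi_nhds] at hlim
  exact tendsto_pi_nhds.2 fun i => tendsto_pi_nhds.2 fun j => hlim (i, j)

end IsStationary

end StationaryState

section Weight

variable {n : Type*} [Fintype n] {ρ : Matrix n n ℂ}

/-- The squared norm `Tr (Y ρ Y†)` of a bond matrix in the state `ρ`. -/
def weight (ρ Y : Matrix n n ℂ) : ℂ :=
  (Y * ρ * Yᴴ).trace

theorem weight_nonneg (hρ : ρ.PosSemidef) (Y : Matrix n n ℂ) : 0 ≤ weight ρ Y :=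
  (hρ.mul_mul_conjTranspose_same Y).trace_nonneg

open scoped MatrixOrder Matrix.Norms.L2Operator in
theorem exists_units_conjTranspose_mul_self [DecidableEq n] (hρ : ρ.PosDef) :
    ∃ P : (Matrix n n ℂ)ˣ, (P : Matrix n n ℂ)ᴴ * P = ρ := by
  obtain ⟨R, hR, hRρ⟩ :=
    CStarAlgebra.isStrictlyPositive_iff_eq_star_mul_self.1 hρ.isStrictlyPositive
  exact ⟨hR.unit, hRρ.symm⟩

theorem weight_eq_zero_iff (hρ : ρ.PosDef) {Y : Matrix n n ℂ} : weight ρ Y = 0 ↔ Y = 0 := by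
  classical
  refine ⟨fun hY => ?_, fun hY => by simp [weight, hY]⟩
  obtain ⟨P, rfl⟩ := exists_units_conjTranspose_mul_self hρ
  have hYP : Y * (P : Matrix n n ℂ)ᴴ = 0 := by
    rw [← Matrix.trace_mul_conjTranspose_self_eq_zero_iff, ← hY, weight,
      Matrix.conjTranspose_mul, Matrix.conjTranspose_conjTranspose]
    simp only [mul_assoc]
  exact (P.isUnit.star.mul_left_eq_zero).1 hYP

theorem weight_smul (ρ : Matrix n n ℂ) (c : ℂ) (Y : Matrix n n ℂ) :
    weight ρ (c • Y) = (‖c‖ ^ 2 : ℝ) * weight ρ Y := by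
  rw [weight, weight, Matrix.conjTranspose_smul, smul_mul_assoc, smul_mul_assoc, mul_smul_comm,
    smul_smul, Matrix.trace_smul, smul_eq_mul, Complex.star_def, Complex.mul_conj,
    Complex.normSq_eq_norm_sq]

theorem weight_eq_trace_conjTranspose_mul_self (ρ Y : Matrix n n ℂ) :
    weight ρ Y = (Yᴴ * Y * ρ).trace := by
  rw [weight, Matrix.trace_mul_comm, mul_assoc]

end Weight

section Pull

variable {σ : Type*} [Fintype σ] {D : ℕ} {A B : Tensor σ D} {ρ : Matrix (Fin D) (Fin D) ℂ}

theorem sum_weight_mul (hB : transfer B ρ = ρ) (Y : Matrix (Fin D) (Fin D) ℂ) :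
    ∑ s, weight ρ (Y * B s) = weight ρ Y := by
  conv_rhs => rw [weight, ← hB, transfer, Finset.mul_sum, Finset.sum_mul, Matrix.trace_sum]
  simp only [weight, Matrix.conjTranspose_mul, mul_assoc]

theorem IsLeftCanonical.sum_weight_mul (hA : IsLeftCanonical A) (Y : Matrix (Fin D) (Fin D) ℂ) :
    ∑ s, weight ρ (A s * Y) = weight ρ Y := by
  rw [weight, ← hA.trace_transfer, transfer, Matrix.trace_sum]
  simp only [weight, Matrix.conjTranspose_mul, mul_assoc]

theorem sum_trace_mul_pull (A B : Tensor σ D) (ρ Y : Matrix (Fin D) (Fin D) ℂ) :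
    ∑ s, (Y * B s * ρ * (A s * pull A B Y)ᴴ).trace = weight ρ (pull A B Y) := by
  have hcycle : ∀ s, (Y * B s * ρ * (A s * pull A B Y)ᴴ).trace
      = ((A s)ᴴ * Y * B s * (ρ * (pull A B Y)ᴴ)).trace := fun s => by
    rw [Matrix.conjTranspose_mul, ← mul_assoc, Matrix.trace_mul_comm]
    simp only [mul_assoc]
  simp_rw [hcycle]
  rw [← Matrix.trace_sum, ← Finset.sum_mul, ← pull, weight, mul_assoc]

/-- Pythagoras: `A · pull A B Y` is the orthogonal projection of `Y · B`. -/
theorem sum_weight_sub (hA : IsLeftCanonical A) (hB : transfer B ρ = ρ) (hρ : ρ.PosSemidef)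
    (Y : Matrix (Fin D) (Fin D) ℂ) :
    ∑ s, weight ρ (Y * B s - A s * pull A B Y) = weight ρ Y - weight ρ (pull A B Y) := by
  have hcross : ∑ s, (A s * pull A B Y * ρ * (Y * B s)ᴴ).trace = weight ρ (pull A B Y) := by
    have hstar := congrArg star (sum_trace_mul_pull A B ρ Y)
    simpa only [(weight_nonneg hρ _).isSelfAdjoint.star_eq, star_sum, ← Matrix.trace_conjTranspose,
      Matrix.conjTranspose_mul, Matrix.conjTranspose_conjTranspose, hρ.isHermitian.eq, mul_assoc]
      using hstar
  have hexpand : ∀ P Q : Matrix (Fin D) (Fin D) ℂ, weight ρ (P - Q)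
      = weight ρ P - (P * ρ * Qᴴ).trace - ((Q * ρ * Pᴴ).trace - weight ρ Q) := fun P Q => by
    simp only [weight, Matrix.conjTranspose_sub, sub_mul, mul_sub, Matrix.trace_sub]
    ring
  simp only [hexpand, Finset.sum_sub_distrib, sum_weight_mul hB, hA.sum_weight_mul, hcross,
    sum_trace_mul_pull, sub_self, sub_zero]

theorem weight_pull_le (hA : IsLeftCanonical A) (hB : transfer B ρ = ρ) (hρ : ρ.PosSemidef)
    (Y : Matrix (Fin D) (Fin D) ℂ) : weight ρ (pull A B Y) ≤ weight ρ Y := by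
  rw [← sub_nonneg, ← sum_weight_sub hA hB hρ]
  exact Finset.sum_nonneg fun s _ => weight_nonneg hρ _

theorem mul_eq_mul_pull_of_weight_eq (hA : IsLeftCanonical A) (hB : transfer B ρ = ρ)
    (hρ : ρ.PosDef) {Y : Matrix (Fin D) (Fin D) ℂ} (hY : weight ρ (pull A B Y) = weight ρ Y)
    (s : σ) : Y * B s = A s * pull A B Y := by
  have hsum := sum_weight_sub hA hB hρ.posSemidef Y
  rw [hY, sub_self, Finset.sum_eq_zero_iff_of_nonneg fun s _ => weight_nonneg hρ.posSemidef _]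
    at hsum
  exact sub_eq_zero.1 ((weight_eq_zero_iff hρ).1 (hsum s (Finset.mem_univ s)))

theorem IsLeftCanonical.transferDual_conjTranspose_mul_self (hA : IsLeftCanonical A)
    {X Y : Matrix (Fin D) (Fin D) ℂ} (h : ∀ s, X * B s = A s * Y) :
    transferDual B (Xᴴ * X) = Yᴴ * Y := by
  have hterm : ∀ s, (B s)ᴴ * (Xᴴ * X) * B s = Yᴴ * ((A s)ᴴ * A s) * Y := fun s => by
    calc (B s)ᴴ * (Xᴴ * X) * B s = (X * B s)ᴴ * (X * B s) := by
          simp only [Matrix.conjTranspose_mul, mul_assoc]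
      _ = Yᴴ * ((A s)ᴴ * A s) * Y := by simp only [h, Matrix.conjTranspose_mul, mul_assoc]
  rw [transferDual, Finset.sum_congr rfl fun s _ => hterm s, ← Finset.sum_mul, ← Finset.mul_sum, hA,
    mul_one]

end Pull

section PullSeq

variable {σ : Type*} [Fintype σ] {D : ℕ} {A : Tensor σ D} {ρ : Matrix (Fin D) (Fin D) ℂ}

/-- The bond matrices obtained from `X` by moving through the sites of the chain, site `j` carrying
the tensors `A` and `B j`. -/
noncomputable def pullSeq (A : Tensor σ D) (B : ℕ → Tensor σ D) (X : Matrix (Fin D) (Fin D) ℂ) :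
    ℕ → Matrix (Fin D) (Fin D) ℂ
  | 0 => X
  | j + 1 => pull A (B j) (pullSeq A B X j)

theorem vec_vecMul_prod_mixedTransfer (A : Tensor σ D) (B : ℕ → Tensor σ D)
    (X : Matrix (Fin D) (Fin D) ℂ) (L : ℕ) :
    Xᵀ.vec ᵥ* (List.ofFn fun j : Fin L => mixedTransfer A (B j)).prod
      = (pullSeq A B X L)ᵀ.vec := by
  induction L with
  | zero => simp [pullSeq]
  | succ L ih =>
    rw [List.ofFn_succ', List.concat_eq_append, List.prod_append, List.prod_singleton,
      ← Matrix.vecMul_vecMul]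
    simp only [Fin.val_castSucc, Fin.val_last]
    rw [ih, vec_vecMul_mixedTransfer, pullSeq]

theorem exists_pullSeq_add_eq_smul {B : ℕ → Tensor σ D} {X : Matrix (Fin D) (Fin D) ℂ} {L : ℕ}
    (hB : ∀ j, ∃ c : Circle, B (j + L) = (c : ℂ) • B j) {μ : Circle}
    (hX : pullSeq A B X L = (μ : ℂ) • X) (j : ℕ) :
    ∃ c : Circle, pullSeq A B X (j + L) = (c : ℂ) • pullSeq A B X j := by
  induction j with
  | zero => exact ⟨μ, by rw [zero_add, hX, pullSeq]⟩
  | succ j ih =>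
    obtain ⟨c, hc⟩ := ih
    obtain ⟨d, hd⟩ := hB j
    exact ⟨d * c, by rw [add_right_comm, pullSeq, hc, hd, pull_smul_left, pull_smul_right,
      smul_smul, mul_comm, Circle.coe_mul, pullSeq]⟩

theorem antitone_weight_pullSeq (hA : IsLeftCanonical A) {B : ℕ → Tensor σ D}
    (hB : ∀ j, transfer (B j) ρ = ρ) (hρ : ρ.PosSemidef) (X : Matrix (Fin D) (Fin D) ℂ) :
    Antitone fun j => weight ρ (pullSeq A B X j) :=
  antitone_nat_of_succ_le fun j => weight_pull_le hA (hB j) hρ _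

theorem norm_le_one_of_pullSeq_eq_smul (hA : IsLeftCanonical A) {B : ℕ → Tensor σ D}
    (hB : ∀ j, transfer (B j) ρ = ρ) (hρ : ρ.PosDef) {X : Matrix (Fin D) (Fin D) ℂ} (hX : X ≠ 0)
    {L : ℕ} {μ : ℂ} (hμ : pullSeq A B X L = μ • X) : ‖μ‖ ≤ 1 := by
  have hle := antitone_weight_pullSeq hA hB hρ.posSemidef X (Nat.zero_le L)
  have hpos : 0 < weight ρ X :=
    (weight_nonneg hρ.posSemidef X).lt_of_ne' (mt (weight_eq_zero_iff hρ).1 hX)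
  simp only [hμ, pullSeq, weight_smul, mul_le_iff_le_one_left hpos] at hle
  exact (sq_le_one_iff₀ (norm_nonneg μ)).1 (by exact_mod_cast hle)

theorem weight_pullSeq_eq (hA : IsLeftCanonical A) {B : ℕ → Tensor σ D}
    (hB : ∀ j, transfer (B j) ρ = ρ) (hρ : ρ.PosSemidef) {X : Matrix (Fin D) (Fin D) ℂ} {L : ℕ}
    (hL : 0 < L)
    (hper : ∀ j, ∃ c : Circle, pullSeq A B X (j + L) = (c : ℂ) • pullSeq A B X j) (j : ℕ) :
    weight ρ (pullSeq A B X j) = weight ρ X := by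
  have hanti := antitone_weight_pullSeq hA hB hρ X
  induction j with
  | zero => rw [pullSeq]
  | succ j ih =>
    rw [← ih]
    refine le_antisymm (hanti j.le_succ) ?_
    obtain ⟨c, hc⟩ := hper j
    calc weight ρ (pullSeq A B X j) = weight ρ (pullSeq A B X (j + L)) := by
          rw [hc, weight_smul, Circle.norm_coe, one_pow, Complex.ofReal_one, one_mul]
      _ ≤ weight ρ (pullSeq A B X (j + 1)) := hanti (Nat.add_le_add_left hL j)

end PullSeq

section BondUnitaries

variable {σ : Type*} [Fintype σ] {D : ℕ} {A : Tensor σ D} {ρ : Matrix (Fin D) (Fin D) ℂ}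

theorem norm_trace_prod_mixedTransfer_pow {u : ℕ → Matrix σ σ ℂ} {L m : ℕ}
    (hsym : ∃ φ : Circle, ∀ s : Fin (m * L) → σ,
      chainOp (fun j : Fin (m * L) => u ((j : ℕ) % L)) (amplitude A (m * L)) s
        = (φ : ℂ) * amplitude A (m * L) s) :
    ‖((List.ofFn fun j : Fin L => mixedTransfer A (act (u j) A)).prod ^ m).trace‖
      = ‖(mixedTransfer A A ^ (m * L)).trace‖ := by
  obtain ⟨φ, hφ⟩ := hsym
  have hB := sum_conj_amplitude_mul_trace A fun j : Fin (m * L) => act (u ((j : ℕ) % L)) A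
  have hA := sum_conj_amplitude_mul_trace A fun _ : Fin (m * L) => A
  simp only [← chainOp_amplitude, hφ, mul_left_comm _ (φ : ℂ), ← Finset.mul_sum] at hB
  rw [List.ofFn_const, List.prod_replicate] at hA
  rw [← list_prod_ofFn_mod m L fun j => mixedTransfer A (act (u j) A), ← hB, ← hA, norm_mul,
    Circle.norm_coe, one_mul]
  rfl

variable [DecidableEq σ]

theorem exists_smul_mem_unitaryGroup {m : Type*} [Fintype m] [DecidableEq m] {w : ℂ} (hw : 0 < w) :
    ∃ t : ℂ, ∀ Z : Matrix m m ℂ, Zᴴ * Z = w • 1 → t • Z ∈ Matrix.unitaryGroup m ℂ := by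
  obtain ⟨x, hx, rfl⟩ := RCLike.pos_iff_exists_ofReal.1 hw
  have hsq : (√x)⁻¹ * (√x)⁻¹ * x = 1 := by
    rw [← mul_inv, Real.mul_self_sqrt hx.le, inv_mul_cancel₀ hx.ne']
  refine ⟨((√x)⁻¹ : ℝ), fun Z hZ => Matrix.mem_unitaryGroup_iff'.2 ?_⟩
  have hsq' : ((√x)⁻¹ : ℝ) * ((√x)⁻¹ : ℝ) * (x : ℂ) = 1 := by exact_mod_cast hsq
  rw [Matrix.star_eq_conjTranspose, Matrix.conjTranspose_smul, smul_mul_smul_comm, hZ, smul_smul,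
    Complex.star_def, Complex.conj_ofReal]
  exact hsq'.symm ▸ one_smul _ _

/-- `Z_j† Z_j` is constant along the subsequence `j + m L`, and it is carried along the chain by the
transfer matrix, whose iterates converge to the expectation value in the state `ρ`. -/
theorem IsStationary.conjTranspose_mul_self_eq_smul_one (h : IsStationary A ρ)
    {u : ℕ → Matrix.unitaryGroup σ ℂ} {Z : ℕ → Matrix (Fin D) (Fin D) ℂ}
    (hZ : ∀ j s, Z j * act (u j) A s = A s * Z (j + 1)) {L : ℕ} (hL : 0 < L)
    (hper : ∀ j, (Z (j + L))ᴴ * Z (j + L) = (Z j)ᴴ * Z j) (j : ℕ) :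
    (Z j)ᴴ * Z j = weight ρ (Z j) • 1 := by
  have hiter : ∀ k, (transferDual A)^[k] ((Z j)ᴴ * Z j) = (Z (j + k))ᴴ * Z (j + k) := fun k => by
    induction k with
    | zero => rfl
    | succ k ih => rw [Function.iterate_succ_apply', ih, ← transferDual_act (u (j + k)),
        h.leftCanonical.transferDual_conjTranspose_mul_self (hZ (j + k)), add_assoc]
  have hper' : ∀ m, (Z (j + m * L))ᴴ * Z (j + m * L) = (Z j)ᴴ * Z j := fun m => by
    induction m with
    | zero => rw [zero_mul, add_zero]
    | succ m ih => rw [Nat.succ_mul, ← add_assoc, hper, ih]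
  have hlim := (h.tendsto_transferDual_iterate ((Z j)ᴴ * Z j)).comp
    (tendsto_id.atTop_mul_const' hL : Tendsto (fun m : ℕ => m * L) atTop atTop)
  simp only [Function.comp_def, hiter, hper', ← weight_eq_trace_conjTranspose_mul_self] at hlim
  exact tendsto_nhds_unique tendsto_const_nhds hlim

theorem IsStationary.exists_unitary_seq_of_eigenvector (h : IsStationary A ρ)
    {u : ℕ → Matrix.unitaryGroup σ ℂ} {L : ℕ} (hL : 0 < L)
    (hper : ∀ j, EqPhase (u (j + L) : Matrix σ σ ℂ) (u j)) {μ : ℂ} (hμ : 1 ≤ ‖μ‖)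
    {x : Fin D × Fin D → ℂ} (hx : x ≠ 0)
    (hxμ : x ᵥ* (List.ofFn fun j : Fin L => mixedTransfer A (act (u j) A)).prod = μ • x) :
    ∃ X : ℕ → Matrix.unitaryGroup (Fin D) ℂ, ∀ j s,
      (X j : Matrix (Fin D) (Fin D) ℂ) * act (u j) A s = A s * X (j + 1) := by
  obtain ⟨Y, rfl⟩ : ∃ Y : Matrix (Fin D) (Fin D) ℂ, Yᵀ.vec = x :=
    let ⟨Y, hY⟩ := Matrix.vec_bijective.2 x
    ⟨Yᵀ, by rw [Matrix.transpose_transpose, hY]⟩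
  have hY : Y ≠ 0 := by simpa using hx
  set B : ℕ → Tensor σ D := fun j => act (u j) A
  have hB : ∀ j, transfer (B j) ρ = ρ := fun j => (transfer_act (u j) A ρ).trans h.fixed
  rw [vec_vecMul_prod_mixedTransfer A B, ← Matrix.vec_smul, Matrix.vec_inj,
    ← Matrix.transpose_smul, Matrix.transpose_inj] at hxμ
  have hμ1 : ‖μ‖ = 1 :=
    (norm_le_one_of_pullSeq_eq_smul h.leftCanonical hB h.posDef hY hxμ).antisymm hμ
  obtain ⟨μ, rfl⟩ : ∃ c : Circle, (c : ℂ) = μ := ⟨⟨μ, mem_sphere_zero_iff_norm.2 hμ1⟩, rfl⟩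
  set Z := pullSeq A B Y
  have hquasi : ∀ j, ∃ c : Circle, Z (j + L) = (c : ℂ) • Z j :=
    exists_pullSeq_add_eq_smul (fun j => (hper j).imp fun c hc => by
      simp only [B, hc, act_smul_left]) hxμ
  have hweight : ∀ j, weight ρ (Z j) = weight ρ Y :=
    weight_pullSeq_eq h.leftCanonical hB h.posDef.posSemidef hL hquasi
  have hinter : ∀ j s, Z j * B j s = A s * Z (j + 1) := fun j =>
    mul_eq_mul_pull_of_weight_eq h.leftCanonical (hB j) h.posDef
      ((hweight (j + 1)).trans (hweight j).symm)
  have hscalar : ∀ j, (Z j)ᴴ * Z j = weight ρ Y • 1 := fun j => by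
    rw [← hweight j]
    refine h.conjTranspose_mul_self_eq_smul_one hinter hL (fun i => ?_) j
    obtain ⟨c, hc⟩ := hquasi i
    rw [hc, Matrix.conjTranspose_smul, smul_mul_smul_comm, Complex.star_def,
      ← Circle.coe_inv_eq_conj, ← Circle.coe_mul, inv_mul_cancel, Circle.coe_one, one_smul]
  obtain ⟨t, ht⟩ := exists_smul_mem_unitaryGroup (m := Fin D)
    ((weight_nonneg h.posDef.posSemidef Y).lt_of_ne' (mt (weight_eq_zero_iff h.posDef).1 hY))
  exact ⟨fun j => ⟨t • Z j, ht _ (hscalar j)⟩, fun j s => by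
    simp only [smul_mul_assoc, mul_smul_comm]; exact congrArg _ (hinter j s)⟩

theorem IsStationary.exists_unitary_seq (h : IsStationary A ρ) {u : ℕ → Matrix.unitaryGroup σ ℂ}
    {L : ℕ} (hL : 0 < L) (hper : ∀ j, EqPhase (u (j + L) : Matrix σ σ ℂ) (u j))
    (hsym : ∀ m : ℕ, 0 < m → ∃ φ : Circle, ∀ s : Fin (m * L) → σ,
      chainOp (fun j : Fin (m * L) => (u ((j : ℕ) % L) : Matrix σ σ ℂ)) (amplitude A (m * L)) s
        = (φ : ℂ) * amplitude A (m * L) s) :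
    ∃ X : ℕ → Matrix.unitaryGroup (Fin D) ℂ, ∀ j s,
      (X j : Matrix (Fin D) (Fin D) ℂ) * act (u j) A s = A s * X (j + 1) := by
  set F := (List.ofFn fun j : Fin L => mixedTransfer A (act (u j) A)).prod
  have hnorm : Tendsto (fun m : ℕ => ‖(F ^ m).trace‖) atTop (𝓝 1) := by
    have hlim := (h.tendsto_trace_mixedTransfer_pow.comp
      (tendsto_id.atTop_mul_const' hL : Tendsto (fun m : ℕ => m * L) atTop atTop)).norm
    rw [norm_one] at hlim
    refine hlim.congr' ?_
    filter_upwards [eventually_gt_atTop 0] with m hm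
    exact (norm_trace_prod_mixedTransfer_pow (u := fun j => (u j : Matrix σ σ ℂ))
      (hsym m hm)).symm
  have hnot : ¬ Tendsto (fun m : ℕ => (F ^ m).trace) atTop (𝓝 0) := fun hzero => by
    have hnorm' := hzero.norm
    rw [norm_zero] at hnorm'
    exact zero_ne_one (tendsto_nhds_unique hnorm' hnorm)
  obtain ⟨μ, x, hx, hxμ, hμ⟩ := exists_vecMul_eq_smul_of_not_tendsto_trace F hnot
  exact h.exists_unitary_seq_of_eigenvector hL hper hμ hx hxμ

end BondUnitaries

section CentralCommutators

variable {G : Type*} [Group G]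

theorem commutatorElement_zpow_right {x y : G} (h : ⁅x, y⁆ ∈ Subgroup.center G) (l : ℤ) :
    ⁅x, y ^ l⁆ = ⁅x, y⁆ ^ l := by
  have hconj : x * y * x⁻¹ = ⁅x, y⁆ * y := by rw [commutatorElement_def, inv_mul_cancel_right]
  have hcomm : Commute ⁅x, y⁆ y := Subgroup.mem_center_iff.1 h y |>.symm
  rw [commutatorElement_def, ← conj_zpow, hconj, hcomm.mul_zpow, mul_inv_cancel_right]

theorem commutatorElement_zpow_zpow {x y : G} (h : ⁅x, y⁆ ∈ Subgroup.center G) (k l : ℤ) :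
    ⁅x ^ k, y ^ l⁆ = ⁅x, y⁆ ^ (k * l) := by
  have hpow : ⁅x ^ k, y⁆ = ⁅x, y⁆ ^ k := by
    have hinv : ⁅y, x⁆ ∈ Subgroup.center G := by
      rw [← commutatorElement_inv]
      exact inv_mem h
    rw [← commutatorElement_inv, commutatorElement_zpow_right hinv, ← inv_zpow,
      commutatorElement_inv]
  rw [commutatorElement_zpow_right (hpow ▸ zpow_mem h k), hpow, zpow_mul]

theorem commutatorElement_eq_of_mk_eq {N : Subgroup G} (hN : N ≤ Subgroup.center G)
    {x x' y y' : G} (hx : (x : G ⧸ N) = x') (hy : (y : G ⧸ N) = y') : ⁅x, y⁆ = ⁅x', y'⁆ := by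
  have hleft : ∀ {x x' : G} (y : G), (x : G ⧸ N) = x' → ⁅x, y⁆ = ⁅x', y⁆ := fun {x x'} y h => by
    have hcomm : Commute y (x⁻¹ * x') := Subgroup.mem_center_iff.1 (hN (QuotientGroup.eq.1 h)) y
    rw [← mul_inv_cancel_left x x', commutatorElement_mul_left_eq_conj_mul,
      hcomm.symm.commutator_eq, mul_one, mul_inv_cancel, one_mul]
  rw [hleft y hx, ← commutatorElement_inv, hleft x' hy, commutatorElement_inv]

end CentralCommutators

section ProjectiveUnitaries

/-- The scalar unitary `c • 1`. -/
noncomputable def scalarUnitary (m : Type*) [Fintype m] [DecidableEq m] :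
    Circle →* Matrix.unitaryGroup m ℂ where
  toFun c := ⟨(c : ℂ) • 1, Matrix.mem_unitaryGroup_iff.2 <| by
    rw [star_smul, star_one, smul_mul_smul_comm, Complex.star_def, ← Circle.coe_inv_eq_conj,
      ← Circle.coe_mul, mul_inv_cancel, Circle.coe_one, one_smul, one_mul]⟩
  map_one' := Subtype.ext (one_smul ℂ _)
  map_mul' c d := Subtype.ext (by simp [smul_smul, mul_comm])

variable {m : Type*} [Fintype m] [DecidableEq m]

theorem coe_scalarUnitary (c : Circle) :
    (scalarUnitary m c : Matrix m m ℂ) = (c : ℂ) • 1 :=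
  rfl

theorem coe_scalarUnitary_mul (c : Circle) (x : Matrix.unitaryGroup m ℂ) :
    ((scalarUnitary m c * x : Matrix.unitaryGroup m ℂ) : Matrix m m ℂ) = (c : ℂ) • x := by
  rw [Matrix.UnitaryGroup.mul_val, coe_scalarUnitary, smul_mul_assoc, one_mul]

theorem scalarUnitary_injective [Nonempty m] : Function.Injective (scalarUnitary m) := by
  intro c d h
  have hval : (c : ℂ) • (1 : Matrix m m ℂ) = (d : ℂ) • 1 := congrArg Subtype.val h
  exact Circle.ext (smul_left_injective ℂ one_ne_zero hval)

theorem range_scalarUnitary_le_center :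
    (scalarUnitary m).range ≤ Subgroup.center (Matrix.unitaryGroup m ℂ) := by
  rintro _ ⟨c, rfl⟩
  refine Subgroup.mem_center_iff.2 fun x => Subtype.ext ?_
  rw [coe_scalarUnitary_mul, Matrix.UnitaryGroup.mul_val, coe_scalarUnitary, mul_smul_comm, mul_one]

instance : (scalarUnitary m).range.Normal where
  conj_mem x hx y := by
    rwa [Subgroup.mem_center_iff.1 (range_scalarUnitary_le_center hx) y, mul_inv_cancel_right]

/-- The projective unitary group, in which equality of classes is equality up to a phase. -/
abbrev ProjectiveUnitary (m : Type*) [Fintype m] [DecidableEq m] : Type _ :=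
  Matrix.unitaryGroup m ℂ ⧸ (scalarUnitary m).range

theorem mk_eq_mk_iff_exists_scalarUnitary_mul {x y : Matrix.unitaryGroup m ℂ} :
    (x : ProjectiveUnitary m) = y ↔ ∃ c, x = scalarUnitary m c * y := by
  rw [eq_comm, QuotientGroup.eq]
  refine exists_congr fun c => ?_
  rw [eq_inv_mul_iff_mul_eq,
    Subgroup.mem_center_iff.1 (range_scalarUnitary_le_center ⟨c, rfl⟩) y, eq_comm]

theorem eq_scalarUnitary_mul_iff {c : Circle} {x y : Matrix.unitaryGroup m ℂ} :
    x = scalarUnitary m c * y ↔ (x : Matrix m m ℂ) = (c : ℂ) • y := by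
  rw [Subtype.ext_iff, coe_scalarUnitary_mul]

theorem eqPhase_iff_mk_eq_mk {x y : Matrix.unitaryGroup m ℂ} :
    EqPhase (x : Matrix m m ℂ) y ↔ (x : ProjectiveUnitary m) = y := by
  simp only [EqPhase, mk_eq_mk_iff_exists_scalarUnitary_mul, eq_scalarUnitary_mul_iff]

theorem mk_scalarUnitary (c : Circle) : (scalarUnitary m c : ProjectiveUnitary m) = 1 :=
  (QuotientGroup.eq_one_iff _).2 ⟨c, rfl⟩

theorem commutatorElement_eq_scalarUnitary_iff {c : Circle} {x y : Matrix.unitaryGroup m ℂ} :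
    ⁅x, y⁆ = scalarUnitary m c ↔ (x : Matrix m m ℂ) * y = (c : ℂ) • ((y : Matrix m m ℂ) * x) := by
  rw [← Matrix.UnitaryGroup.mul_val, ← Matrix.UnitaryGroup.mul_val, ← eq_scalarUnitary_mul_iff,
    commutatorElement_def, mul_assoc, ← mul_inv_rev, mul_inv_eq_iff_eq_mul]

theorem commutatorElement_zpow_zpow_eq_scalarUnitary {c : Circle} {x y : Matrix.unitaryGroup m ℂ}
    (h : ⁅x, y⁆ = scalarUnitary m c) (k l : ℤ) :
    ⁅x ^ k, y ^ l⁆ = scalarUnitary m (c ^ (k * l)) := by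
  rw [commutatorElement_zpow_zpow (range_scalarUnitary_le_center ⟨c, h.symm⟩), h, map_zpow]

end ProjectiveUnitaries

section RootPhase

theorem rootPhase_mul_rootPhase (M : ℕ) (k l : ℤ) :
    rootPhase M k * rootPhase M l = rootPhase M (k + l) := by
  rw [rootPhase, rootPhase, rootPhase, ← Circle.exp_add, ← add_div, ← mul_add, Int.cast_add]

theorem rootPhase_zpow (M : ℕ) (k l : ℤ) : rootPhase M k ^ l = rootPhase M (k * l) := by
  rw [rootPhase, rootPhase, ← Circle.exp_zsmul, zsmul_eq_mul, Int.cast_mul]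
  ring_nf

theorem rootPhase_eq_rootPhase_iff {M : ℕ} [NeZero M] {k l : ℤ} :
    rootPhase M k = rootPhase M l ↔ k ≡ l [ZMOD M] := by
  have hchar : ∀ j : ℤ, rootPhase M j = ZMod.toCircle (j : ZMod M) := fun j => Circle.ext <| by
    rw [ZMod.toCircle_intCast, rootPhase, Circle.coe_exp]
    push_cast
    ring_nf
  rw [hchar, hchar, ZMod.injective_toCircle.eq_iff, ZMod.intCast_eq_intCast_iff]

theorem rootPhase_eq_one_iff {M : ℕ} [NeZero M] {k : ℤ} : rootPhase M k = 1 ↔ (M : ℤ) ∣ k := by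
  have hzero : rootPhase M 0 = 1 := by simp [rootPhase]
  rw [← hzero, rootPhase_eq_rootPhase_iff, Int.modEq_zero_iff_dvd]

theorem exists_eq_rootPhase {M : ℕ} [NeZero M] {c : Circle} (hc : c ^ M = 1) :
    ∃ k : ℤ, c = rootPhase M k := by
  have hexp : Circle.exp (M * Complex.arg c) = Circle.exp 0 := by
    rw [Circle.exp_zero, ← hc, ← nsmul_eq_mul, Circle.exp_nsmul, Circle.exp_arg]
  obtain ⟨k, hk⟩ := Circle.exp_eq_exp.1 hexp
  have harg : Complex.arg c = 2 * Real.pi * k / M := by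
    rw [eq_div_iff (NeZero.ne (M : ℝ)), mul_comm, hk, zero_add, mul_comm]
  exact ⟨k, by rw [rootPhase, ← harg, Circle.exp_arg]⟩

theorem exists_commutatorElement_eq_rootPhase {m : Type*} [Fintype m] [DecidableEq m] [Nonempty m]
    {x y : Matrix.unitaryGroup m ℂ} {N N' : ℕ} [NeZero N] (hx : (x : ProjectiveUnitary m) ^ N = 1)
    (hy : (y : ProjectiveUnitary m) ^ N' = 1)
    (hxy : Commute (x : ProjectiveUnitary m) y) :
    ∃ k, ⁅x, y⁆ = scalarUnitary m (rootPhase (N.gcd N') k) := by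
  obtain ⟨c, hc⟩ := mk_eq_mk_iff_exists_scalarUnitary_mul.1
    (show ((x * y : Matrix.unitaryGroup m ℂ) : ProjectiveUnitary m) = ↑(y * x) from hxy.eq)
  have hcomm : ⁅x, y⁆ = scalarUnitary m c := by
    rw [commutatorElement_def, hc, mul_assoc, mul_assoc, mul_assoc]
    simp
  have hpow : ∀ k l : ℤ, (x : ProjectiveUnitary m) ^ k = 1 ∨ (y : ProjectiveUnitary m) ^ l = 1 →
      c ^ (k * l) = 1 := fun k l h => scalarUnitary_injective <| by
    rw [← commutatorElement_zpow_zpow_eq_scalarUnitary hcomm, map_one]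
    rcases h with h | h
    · rw [commutatorElement_eq_of_mk_eq range_scalarUnitary_le_center (x' := 1) h rfl,
        commutatorElement_one_left]
    · rw [commutatorElement_eq_of_mk_eq range_scalarUnitary_le_center (y' := 1) rfl h,
        commutatorElement_one_right]
  have : NeZero (N.gcd N') := ⟨Nat.gcd_ne_zero_left (NeZero.ne N)⟩
  obtain ⟨k, rfl⟩ := exists_eq_rootPhase (M := N.gcd N') (c := c) <| pow_gcd_eq_one.2
    ⟨by simpa using hpow N 1 (.inl (by simpa using hx)),
      by simpa using hpow 1 N' (.inr (by simpa using hy))⟩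
  exact ⟨k, hcomm⟩

theorem mul_pow_modEq_of_isPeriodic {m : Type*} [Fintype m] [DecidableEq m] [Nonempty m]
    {x y : Matrix.unitaryGroup m ℂ} {M L : ℕ} [NeZero M] {a b k : ℤ} (hx : IsPeriodic L x a)
    (hy : IsPeriodic L y b) (h : ⁅x, y⁆ = scalarUnitary m (rootPhase M k)) :
    k * (a * b) ^ L ≡ k [ZMOD M] := by
  rw [← rootPhase_eq_rootPhase_iff, ← scalarUnitary_injective.eq_iff (f := scalarUnitary m), ← h,
    ← rootPhase_zpow, mul_pow, ← commutatorElement_zpow_zpow_eq_scalarUnitary h]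
  exact commutatorElement_eq_of_mk_eq range_scalarUnitary_le_center
    (eqPhase_iff_mk_eq_mk.1 hx) (eqPhase_iff_mk_eq_mk.1 hy)

end RootPhase

section Cocycles

variable {D : ℕ} {G : Type*} {V : G → Matrix.unitaryGroup (Fin D) ℂ} {ω : G → G → Circle}

theorem hasCocycle_iff [Add G] :
    HasCocycle V ω ↔ ∀ g h, V g * V h = scalarUnitary (Fin D) (ω g h) * V (g + h) := by
  simp only [HasCocycle, eq_scalarUnitary_mul_iff, Matrix.UnitaryGroup.mul_val]

theorem exists_hasCocycle [Add G]
    (h : ∀ g h, (V g : ProjectiveUnitary (Fin D)) * V h = V (g + h)) : ∃ ω, HasCocycle V ω := by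
  have hscalar : ∀ g h, ∃ c, V g * V h = scalarUnitary (Fin D) c * V (g + h) := fun g k =>
    mk_eq_mk_iff_exists_scalarUnitary_mul.1 (h g k)
  choose ω hω using hscalar
  exact ⟨ω, hasCocycle_iff.2 hω⟩

theorem HasCocycle.commutatorElement_eq [AddCommMagma G] (h : HasCocycle V ω) (g k : G) :
    ⁅V g, V k⁆ = scalarUnitary (Fin D) (ω g k * (ω k g)⁻¹) := by
  rw [hasCocycle_iff] at h
  rw [commutatorElement_def, mul_assoc, ← mul_inv_rev, h g k, h k g, add_comm k g, mul_inv_rev,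
    ← mul_assoc, mul_inv_cancel_right, map_mul, map_inv]

theorem IsCoboundary.mul_inv_eq_one [AddCommMagma G] (h : IsCoboundary ω) (g k : G) :
    ω g k * (ω k g)⁻¹ = 1 := by
  obtain ⟨β, hβ⟩ := h
  rw [hβ, hβ, add_comm k g, mul_comm (β k), mul_inv_cancel]

end Cocycles

section OrderedProducts

variable {M : Type*} [Monoid M] {n : ℕ}

theorem noncommProd_univ_eq_prod_ofFn (f : Fin n → M) (comm) :
    Finset.univ.noncommProd f comm = (List.ofFn f).prod := by
  rw [List.ofFn_eq_map, ← Multiset.noncommProd_coe _ fun x hx y hy hxy => ?_]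
  · rfl
  · obtain ⟨i, -, rfl⟩ := List.mem_map.1 hx
    obtain ⟨j, -, rfl⟩ := List.mem_map.1 hy
    exact comm (by simp) (by simp) (fun hij => hxy (hij ▸ rfl))

theorem prod_ofFn_mul_prod_ofFn {f g : Fin n → M} (hff : ∀ i j, Commute (f i) (f j))
    (hgg : ∀ i j, Commute (g i) (g j)) (hgf : ∀ i j, Commute (g i) (f j)) :
    (List.ofFn f).prod * (List.ofFn g).prod = (List.ofFn fun i => f i * g i).prod := by
  have hf : Set.Pairwise ↑(Finset.univ : Finset (Fin n)) (Function.onFun Commute f) :=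
    fun i _ j _ _ => hff i j
  have hg : Set.Pairwise ↑(Finset.univ : Finset (Fin n)) (Function.onFun Commute g) :=
    fun i _ j _ _ => hgg i j
  rw [← noncommProd_univ_eq_prod_ofFn f hf, ← noncommProd_univ_eq_prod_ofFn g hg,
    ← Finset.noncommProd_mul_distrib f g hf hg fun i _ j _ _ => hgf i j,
    noncommProd_univ_eq_prod_ofFn]
  rfl

theorem prod_ofFn_eq_of_ne_eq_one {f : Fin n → M} (i : Fin n) (h : ∀ j, j ≠ i → f j = 1) :
    (List.ofFn f).prod = f i := by
  have hcomm : Set.Pairwise ↑(Finset.univ : Finset (Fin n)) (Function.onFun Commute f) := by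
    intro j _ k _ hjk
    rcases eq_or_ne j i with rfl | hj
    · rw [Function.onFun, h k hjk.symm]
      exact Commute.one_right _
    · rw [Function.onFun, h j hj]
      exact Commute.one_left _
  rw [← noncommProd_univ_eq_prod_ofFn f hcomm,
    ← Finset.mul_noncommProd_erase _ (Finset.mem_univ i) f hcomm
      (hcomm.mono (Finset.coe_subset.2 (Finset.erase_subset _ _))),
    Finset.noncommProd_eq_pow_card _ _ _ 1 fun j hj => h j (Finset.ne_of_mem_erase hj), one_pow,
    mul_one]

end OrderedProducts

section BondOp

variable {D r : ℕ} {N : Fin r → ℕ} (a : Fin r → ℤ) {v : Fin r → Matrix.unitaryGroup (Fin D) ℂ}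

theorem zpow_eq_zpow_of_modEq {G : Type*} [Group G] {x : G} {N : ℕ} (hx : x ^ N = 1) {k l : ℤ}
    (h : k ≡ l [ZMOD N]) : x ^ k = x ^ l :=
  zpow_eq_zpow_iff_modEq.2 (h.of_dvd (Int.natCast_dvd_natCast.2 (orderOf_dvd_of_pow_eq_one hx)))

theorem mk_bondOp (N : Fin r → ℕ) (v : Fin r → Matrix.unitaryGroup (Fin D) ℂ) (j : ℕ)
    (g : ∀ I, ZMod (N I)) :
    (bondOp N a v j g : ProjectiveUnitary (Fin D))
      = (List.ofFn fun I =>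
          (v I : ProjectiveUnitary (Fin D)) ^ (a I ^ j * ((g I).val : ℤ))).prod := by
  rw [bondOp, ← QuotientGroup.mk'_apply, map_list_prod, List.map_ofFn]
  rfl

theorem mk_bondOp_mul_mk_bondOp [∀ I, NeZero (N I)]
    (hpow : ∀ I, (v I : ProjectiveUnitary (Fin D)) ^ N I = 1)
    (hcomm : ∀ I J, Commute (v I : ProjectiveUnitary (Fin D)) (v J)) (j : ℕ)
    (g h : ∀ I, ZMod (N I)) :
    (bondOp N a v j g : ProjectiveUnitary (Fin D)) * bondOp N a v j h = bondOp N a v j (g + h) := by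
  rw [mk_bondOp, mk_bondOp, mk_bondOp, prod_ofFn_mul_prod_ofFn
    (fun I J => (hcomm I J).zpow_zpow _ _) (fun I J => (hcomm I J).zpow_zpow _ _)
    fun I J => (hcomm I J).zpow_zpow _ _]
  congr 2 with I
  rw [← zpow_add, ← mul_add]
  refine zpow_eq_zpow_of_modEq (hpow I) (Int.ModEq.mul_left _ ?_)
  exact (ZMod.intCast_eq_intCast_iff _ _ _).1 (by simp)

theorem mk_bondOp_single {I : Fin r} [NeZero (N I)]
    (hpow : (v I : ProjectiveUnitary (Fin D)) ^ N I = 1) (j : ℕ) :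
    (bondOp N a v j (Pi.single I 1) : ProjectiveUnitary (Fin D))
      = (v I ^ (a I ^ j) : Matrix.unitaryGroup (Fin D) ℂ) := by
  rw [mk_bondOp, prod_ofFn_eq_of_ne_eq_one I fun J hJ => by simp [hJ], Pi.single_eq_same,
    QuotientGroup.mk_zpow]
  refine zpow_eq_zpow_of_modEq hpow ((ZMod.intCast_eq_intCast_iff _ _ _).1 ?_)
  simp

theorem isBondClass_of_commutatorElement_eq [Nonempty (Fin D)] {I J : Fin r} [NeZero (N I)]
    [NeZero (N J)] (hI : (v I : ProjectiveUnitary (Fin D)) ^ N I = 1)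
    (hJ : (v J : ProjectiveUnitary (Fin D)) ^ N J = 1) {M : ℕ} {k : ℤ}
    (h : ⁅v I, v J⁆ = scalarUnitary (Fin D) (rootPhase M k)) : IsBondClass N a v I J M k := by
  intro j
  have hpow := commutatorElement_zpow_zpow_eq_scalarUnitary h (a I ^ j) (a J ^ j)
  rw [rootPhase_zpow, ← mul_pow] at hpow
  refine ⟨commutatorElement_eq_scalarUnitary_iff.1 hpow, fun ω hω => ?_⟩
  apply scalarUnitary_injective (m := Fin D)
  rw [← hω.commutatorElement_eq, ← hpow]
  exact commutatorElement_eq_of_mk_eq range_scalarUnitary_le_center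
    (mk_bondOp_single a hI j) (mk_bondOp_single a hJ j)

end BondOp

section BondEquation

variable {M : ℕ} {q n k : ℤ}

theorem exists_solvesBondEquation_iff :
    (∃ k : ℤ, SolvesBondEquation M q n k) ↔ (Int.gcd (q - 1) M : ℤ) ∣ n := by
  rw [Int.coe_gcd, gcd_dvd_iff_exists]
  refine exists_congr fun k => ?_
  rw [SolvesBondEquation, Int.modEq_iff_dvd]
  exact exists_congr fun m => by rw [sub_eq_iff_eq_add', mul_comm k]

theorem isCoprime_ediv_gcd [NeZero M] (q : ℤ) :
    IsCoprime (q / (Int.gcd q M : ℤ)) (M / (Int.gcd q M : ℤ)) :=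
  Int.isCoprime_iff_gcd_eq_one.2
    (Int.gcd_ediv_gcd_ediv_gcd (Int.gcd_pos_of_ne_zero_right _ (NeZero.ne (M : ℤ))))

theorem exists_mul_ediv_gcd_modEq_one [NeZero M] (q : ℤ) :
    ∃ u : ℤ, u * (q / (Int.gcd q M : ℤ)) ≡ 1 [ZMOD (M : ℤ) / (Int.gcd q M : ℤ)] := by
  obtain ⟨u, w, huw⟩ := isCoprime_ediv_gcd (M := M) q
  exact ⟨u, Int.modEq_iff_dvd.2 ⟨w, by linear_combination -huw⟩⟩

theorem mul_modEq_iff_modEq_mul_of_mul_modEq_one {M p u : ℤ} (hu : u * p ≡ 1 [ZMOD M]) (n k : ℤ) :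
    k * p ≡ n [ZMOD M] ↔ k ≡ n * u [ZMOD M] := by
  constructor <;> intro h
  · calc k = k * 1 := (mul_one k).symm
      _ ≡ k * (u * p) [ZMOD M] := hu.symm.mul_left k
      _ = k * p * u := by ring
      _ ≡ n * u [ZMOD M] := h.mul_right u
  · calc k * p ≡ n * u * p [ZMOD M] := h.mul_right p
      _ = n * (u * p) := by ring
      _ ≡ n * 1 [ZMOD M] := hu.mul_left n
      _ = n := mul_one n

theorem modEq_iff_existsUnique_lt_modEq_add_mul {c : ℕ} (hc : 0 < c) {m : ℤ} (hm : m ≠ 0)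
    (k x : ℤ) :
    k ≡ x [ZMOD m] ↔ ∃! τ : ℕ, τ < c ∧ k ≡ x + τ * m [ZMOD c * m] := by
  have hc' : (0 : ℤ) < c := by exact_mod_cast hc
  have hshift : ∀ s τ : ℤ, x + s * m ≡ x + τ * m [ZMOD c * m] ↔ s ≡ τ [ZMOD c] := fun s τ => by
    rw [Int.modEq_iff_dvd, Int.modEq_iff_dvd, add_sub_add_left_eq_sub, ← sub_mul,
      mul_dvd_mul_iff_right hm]
  constructor
  · intro h
    obtain ⟨s, hs⟩ := h.symm.dvd
    obtain rfl : k = x + s * m := by linear_combination hs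
    simp only [hshift]
    refine ⟨(s % c).toNat, ⟨?_, ?_⟩, fun τ hτ => ?_⟩
    · rw [Int.toNat_lt (Int.emod_nonneg _ hc'.ne')]
      exact Int.emod_lt_of_pos s hc'
    · rw [Int.toNat_of_nonneg (Int.emod_nonneg _ hc'.ne')]
      exact (Int.mod_modEq s c).symm
    · rw [hτ.2.eq, Int.emod_eq_of_lt (Int.natCast_nonneg τ) (by exact_mod_cast hτ.1),
        Int.toNat_natCast]
  · rintro ⟨τ, ⟨-, h⟩, -⟩
    exact (h.of_mul_left _).trans (by simp [Int.modEq_iff_dvd])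

theorem solvesBondEquation_iff_existsUnique [NeZero M] (hn : (Int.gcd (q - 1) M : ℤ) ∣ n) {u : ℤ}
    (hu : u * ((q - 1) / (Int.gcd (q - 1) M : ℤ)) ≡ 1
      [ZMOD (M : ℤ) / (Int.gcd (q - 1) M : ℤ)]) (k : ℤ) :
    SolvesBondEquation M q n k ↔ ∃! τ : ℕ, τ < Int.gcd (q - 1) M ∧
      k ≡ n / (Int.gcd (q - 1) M : ℤ) * u + τ * ((M : ℤ) / (Int.gcd (q - 1) M : ℤ))
        [ZMOD (M : ℤ)] := by
  set c := Int.gcd (q - 1) M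
  have hc : 0 < c := Int.gcd_pos_of_ne_zero_right _ (NeZero.ne (M : ℤ))
  have hc' : (c : ℤ) ≠ 0 := by exact_mod_cast hc.ne'
  have hM : (c : ℤ) * (M / c) = M := Int.mul_ediv_cancel' (Int.gcd_dvd_right _ _)
  have hm : (M : ℤ) / c ≠ 0 := right_ne_zero_of_mul (hM.trans_ne (NeZero.ne (M : ℤ)))
  calc SolvesBondEquation M q n k
      ↔ c * (k * ((q - 1) / c)) ≡ c * (n / c) [ZMOD c * (M / c)] := by
        rw [SolvesBondEquation, hM, mul_left_comm, Int.mul_ediv_cancel' hn,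
          Int.mul_ediv_cancel' (Int.gcd_dvd_left _ _)]
    _ ↔ k * ((q - 1) / c) ≡ n / c [ZMOD M / c] := Int.ModEq.mul_left_cancel_iff' hc'
    _ ↔ k ≡ n / c * u [ZMOD M / c] := mul_modEq_iff_modEq_mul_of_mul_modEq_one hu _ _
    _ ↔ _ := by rw [modEq_iff_existsUnique_lt_modEq_add_mul hc hm, hM]

theorem SolvesBondEquation.not_dvd (h : SolvesBondEquation M q n k) (hn : ¬ (M : ℤ) ∣ n) :
    ¬ (M : ℤ) ∣ k := fun hk =>
  hn (h.dvd_iff.1 (hk.mul_right _))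

theorem SolvesBondEquation.dvd_of_dvd_mul_pow (h : SolvesBondEquation M q n k) {L : ℕ} (hL : 0 < L)
    (hper : n * q ^ L ≡ n [ZMOD M]) {j : ℕ} (hk : (M : ℤ) ∣ k * q ^ j) : (M : ℤ) ∣ n := by
  have hiter : ∀ i : ℕ, n * (q ^ L) ^ i ≡ n [ZMOD M] := fun i => by
    induction i with
    | zero => rw [pow_zero, mul_one]
    | succ i ih =>
      rw [pow_succ, ← mul_assoc]
      exact (ih.mul_right _).trans hper
  have hn : (M : ℤ) ∣ n * q ^ j := by
    refine ((h.mul_right _).dvd_iff).1 ?_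
    rw [mul_right_comm]
    exact hk.mul_right _
  refine (hiter j).dvd_iff.1 (hn.trans (mul_dvd_mul_left n ?_))
  rw [← pow_mul]
  exact pow_dvd_pow q (Nat.le_mul_of_pos_left j hL)

theorem forall_solvesBondEquation_not_dvd_iff :
    (∀ k : ℤ, SolvesBondEquation M q n k → ¬ (M : ℤ) ∣ k) ↔ ¬ (M : ℤ) ∣ n := by
  refine ⟨fun h hn => h 0 ?_ (dvd_zero _), fun hn k hk => hk.not_dvd hn⟩
  rw [SolvesBondEquation, zero_mul]
  exact (Int.modEq_zero_iff_dvd.2 hn).symm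

end BondEquation

section Intertwiners

variable {σ : Type*} [Fintype σ] {D : ℕ}

theorem act_one [DecidableEq σ] (A : Tensor σ D) : act 1 A = A := by
  funext s
  simp [act, Matrix.one_apply]

theorem act_mul (u w : Matrix σ σ ℂ) (A : Tensor σ D) : act (u * w) A = act u (act w A) := by
  funext s
  simp only [act, Matrix.mul_apply, Finset.sum_smul, Finset.smul_sum, mul_smul]
  exact Finset.sum_comm

theorem act_mul_mul (u : Matrix σ σ ℂ) (X Y : Matrix (Fin D) (Fin D) ℂ) (A : Tensor σ D) (s : σ) :
    act u (fun t => X * A t * Y) s = X * act u A s * Y := by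
  simp only [act, Finset.mul_sum, Finset.sum_mul, mul_smul_comm, smul_mul_assoc]

section Intertwine

variable {A : Tensor σ D} {u u' : Matrix σ σ ℂ} {v v' w w' : Matrix (Fin D) (Fin D) ℂ}

theorem mul_act_mul_eq (h : ∀ s, v * act u A s = A s * w) (h' : ∀ s, v' * act u' A s = A s * w')
    (s : σ) : v * v' * act (u * u') A s = A s * (w * w') :=
  calc v * v' * act (u * u') A s
      = v * act u (fun t => v' * act u' A t * 1) s := by
        rw [act_mul, act_mul_mul, mul_one, mul_assoc]
    _ = v * act u (fun t => 1 * A t * w') s := by simp only [h' _, mul_one, one_mul]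
    _ = A s * (w * w') := by rw [act_mul_mul, one_mul, ← mul_assoc, h s, mul_assoc]

theorem mul_act_eq_of_mul_eq_one [DecidableEq σ] (hu : u' * u = 1) (hv : v' * v = 1)
    (hw : w * w' = 1) (h : ∀ s, v * act u A s = A s * w) (s : σ) :
    v' * act u' A s = A s * w' := by
  have hact : act u A = fun t => v' * A t * w := by
    funext t
    rw [mul_assoc, ← h t, ← mul_assoc, hv, one_mul]
  have hA : v' * act u' A s * w = A s := by
    rw [← act_mul_mul, ← hact, ← act_mul, hu, act_one]
  rw [← hA, mul_assoc, hw, mul_one]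

end Intertwine

variable [DecidableEq σ]

/-- The triples `(u, v, w)` of an on-site unitary and two bond unitaries with `v (u · A) = A w`:
acting with `u` on the site amounts to inserting `v†` on the left bond and `w` on the right. -/
def intertwiners (A : Tensor σ D) : Subgroup
    (Matrix.unitaryGroup σ ℂ × Matrix.unitaryGroup (Fin D) ℂ × Matrix.unitaryGroup (Fin D) ℂ) where
  carrier := {p | ∀ s, (p.2.1 : Matrix (Fin D) (Fin D) ℂ) * act p.1 A s = A s * p.2.2}
  one_mem' s := by simp [act_one]
  mul_mem' h h' := mul_act_mul_eq h h'
  inv_mem' {p} h := mul_act_eq_of_mul_eq_one (congrArg Subtype.val (inv_mul_cancel p.1))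
    (congrArg Subtype.val (inv_mul_cancel p.2.1)) (congrArg Subtype.val (mul_inv_cancel p.2.2)) h

theorem scalarUnitary_mul_act_scalarUnitary (A : Tensor σ D) (c d : Circle) (s : σ) :
    (scalarUnitary (Fin D) d : Matrix (Fin D) (Fin D) ℂ) *
        act (scalarUnitary σ c : Matrix σ σ ℂ) A s =
      A s * (scalarUnitary (Fin D) (c * d) : Matrix (Fin D) (Fin D) ℂ) := by
  rw [coe_scalarUnitary, coe_scalarUnitary, coe_scalarUnitary, act_smul_left, act_one,
    Pi.smul_apply, smul_mul_smul_comm, one_mul, mul_smul_comm, mul_one, Circle.coe_mul,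
    mul_comm (d : ℂ)]

theorem scalarUnitary_mem_intertwiners (A : Tensor σ D) (c d : Circle) :
    (scalarUnitary σ c, scalarUnitary (Fin D) d, scalarUnitary (Fin D) (c * d)) ∈ intertwiners A :=
  scalarUnitary_mul_act_scalarUnitary A c d

theorem mul_eq_of_scalarUnitary_mem_intertwiners {A : Tensor σ D} (hA : ∃ s, A s ≠ 0)
    {c d e : Circle} (h : (scalarUnitary σ c, scalarUnitary (Fin D) d, scalarUnitary (Fin D) e)
      ∈ intertwiners A) : c * d = e := by
  obtain ⟨s, hs⟩ := hA
  have hscalar := (scalarUnitary_mul_act_scalarUnitary A c d s).symm.trans (h s)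
  simp only [coe_scalarUnitary, mul_smul_comm, mul_one] at hscalar
  exact Circle.ext (smul_left_injective ℂ hs hscalar)

end Intertwiners

section ProjectiveIntertwiners

variable {σ : Type*} [Fintype σ] [DecidableEq σ] {D : ℕ} {A : Tensor σ D}

/-- The image of `intertwiners A` in the projective unitary groups, so that all phases are
forgotten. -/
noncomputable def projectiveIntertwiners (A : Tensor σ D) :
    Subgroup (ProjectiveUnitary σ × ProjectiveUnitary (Fin D) × ProjectiveUnitary (Fin D)) :=
  (intertwiners A).map
    ((QuotientGroup.mk' _).prodMap ((QuotientGroup.mk' _).prodMap (QuotientGroup.mk' _)))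

theorem mk_mem_projectiveIntertwiners_iff {u : Matrix.unitaryGroup σ ℂ}
    {v w : Matrix.unitaryGroup (Fin D) ℂ} :
    (↑u, ↑v, ↑w) ∈ projectiveIntertwiners A ↔
      ∃ c, (u, v, scalarUnitary (Fin D) c * w) ∈ intertwiners A := by
  constructor
  · rintro ⟨⟨u', v', w'⟩, hmem, heq⟩
    obtain ⟨hu, hv, hw⟩ := by simpa only [Prod.ext_iff] using heq
    obtain ⟨c, rfl⟩ := mk_eq_mk_iff_exists_scalarUnitary_mul.1 hu
    obtain ⟨d, rfl⟩ := mk_eq_mk_iff_exists_scalarUnitary_mul.1 hv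
    obtain ⟨e, rfl⟩ := mk_eq_mk_iff_exists_scalarUnitary_mul.1 hw
    refine ⟨c⁻¹ * d⁻¹ * e, ?_⟩
    have hscalar := scalarUnitary_mem_intertwiners A c⁻¹ d⁻¹
    simpa [← mul_assoc, ← map_inv, ← map_mul] using mul_mem hscalar hmem
  · rintro ⟨c, hc⟩
    refine ⟨_, hc, ?_⟩
    exact Prod.ext rfl (Prod.ext rfl (mk_eq_mk_iff_exists_scalarUnitary_mul.2 ⟨c, rfl⟩))

theorem exists_mem_intertwiners {u : Matrix.unitaryGroup σ ℂ} {v : Matrix.unitaryGroup (Fin D) ℂ}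
    {y : ProjectiveUnitary (Fin D)} (h : (↑u, ↑v, y) ∈ projectiveIntertwiners A) :
    ∃ w : Matrix.unitaryGroup (Fin D) ℂ, (u, v, w) ∈ intertwiners A ∧ ↑w = y := by
  obtain ⟨w, rfl⟩ := QuotientGroup.mk_surjective y
  obtain ⟨c, hc⟩ := mk_mem_projectiveIntertwiners_iff.1 h
  exact ⟨_, hc, by rw [QuotientGroup.mk_mul, mk_scalarUnitary, one_mul]⟩

theorem IsLeftCanonical.transferDual_eq_of_mem (hA : IsLeftCanonical A)
    {v w : Matrix.unitaryGroup (Fin D) ℂ} (h : (1, v, w) ∈ intertwiners A) :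
    transferDual A v = w := by
  have hvw : ∀ s, (v : Matrix (Fin D) (Fin D) ℂ) * A s = A s * w := fun s => by
    simpa [act_one] using h s
  simp only [transferDual, mul_assoc, hvw]
  simp only [← mul_assoc, ← Finset.sum_mul]
  rw [hA, one_mul]

theorem IsLeftCanonical.exists_unitary_eq_transferDual_iterate (hA : IsLeftCanonical A)
    {x : ℕ → ProjectiveUnitary (Fin D)}
    (hx : ∀ j, (1, x j, x (j + 1)) ∈ projectiveIntertwiners A)
    {v : Matrix.unitaryGroup (Fin D) ℂ} (hv : v = x 0) (k : ℕ) :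
    ∃ w : Matrix.unitaryGroup (Fin D) ℂ, ↑w = x k ∧ (transferDual A)^[k] v = w := by
  induction k with
  | zero => exact ⟨v, hv, rfl⟩
  | succ k ih =>
    obtain ⟨w, hw, hiter⟩ := ih
    obtain ⟨w', hmem, hw'⟩ := exists_mem_intertwiners (u := 1) (hw ▸ hx k)
    exact ⟨w', hw', by
      rw [Function.iterate_succ_apply', hiter, hA.transferDual_eq_of_mem hmem]⟩

theorem exists_circle_coe_eq_of_smul_one_mem {m : Type*} [Fintype m] [DecidableEq m] [Nonempty m]
    {t : ℂ} (h : t • (1 : Matrix m m ℂ) ∈ Matrix.unitaryGroup m ℂ) : ∃ c : Circle, (c : ℂ) = t := by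
  rw [Matrix.mem_unitaryGroup_iff, star_smul, star_one, smul_mul_smul_comm, one_mul,
    Complex.star_def, Complex.mul_conj'] at h
  have hsq : ((‖t‖ : ℂ)) ^ 2 = 1 :=
    smul_left_injective ℂ (one_ne_zero (α := Matrix m m ℂ)) (h.trans (one_smul ℂ _).symm)
  exact ⟨⟨t, mem_sphere_zero_iff_norm.2
    ((pow_eq_one_iff_of_nonneg (norm_nonneg t) two_ne_zero).1 (by exact_mod_cast hsq))⟩, rfl⟩

/-- Equality case of the Cauchy–Schwarz inequality for the inner product `tr (X ρ Yᴴ)`. -/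
theorem eq_trace_smul_one_of_norm_trace_eq_one {m : Type*} [Fintype m] [DecidableEq m]
    {ρ : Matrix m m ℂ} (hρ : ρ.PosDef) (htr : ρ.trace = 1) {v : Matrix.unitaryGroup m ℂ}
    (hv : ‖((v : Matrix m m ℂ) * ρ).trace‖ = 1) :
    (v : Matrix m m ℂ) = ((v : Matrix m m ℂ) * ρ).trace • 1 := by
  set t := ((v : Matrix m m ℂ) * ρ).trace with ht
  have htt : t * star t = 1 := by
    rw [Complex.star_def, Complex.mul_conj, Complex.normSq_eq_norm_sq, hv]
    norm_num
  have hcross : (ρ * (v : Matrix m m ℂ)ᴴ).trace = star t := by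
    rw [ht, ← Matrix.trace_conjTranspose, Matrix.conjTranspose_mul, hρ.isHermitian.eq]
  have hdiag : ((v : Matrix m m ℂ) * ρ * (v : Matrix m m ℂ)ᴴ).trace = 1 := by
    rw [Matrix.trace_mul_comm, ← mul_assoc, ← Matrix.star_eq_conjTranspose,
      Matrix.UnitaryGroup.star_mul_self, one_mul, htr]
  rw [← sub_eq_zero, ← weight_eq_zero_iff hρ, weight]
  simp only [Matrix.conjTranspose_sub, Matrix.conjTranspose_smul, Matrix.conjTranspose_one, sub_mul,
    mul_sub, smul_mul_assoc, mul_smul_comm, one_mul, mul_one, Matrix.trace_sub, Matrix.trace_smul,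
    smul_eq_mul, hcross, hdiag, htr, ← ht]
  linear_combination -htt

theorem IsStationary.eq_one_of_forall_mem {ρ : Matrix (Fin D) (Fin D) ℂ} (h : IsStationary A ρ)
    {x : ℕ → ProjectiveUnitary (Fin D)}
    (hx : ∀ j, (1, x j, x (j + 1)) ∈ projectiveIntertwiners A) : x 0 = 1 := by
  obtain ⟨v, hv⟩ := QuotientGroup.mk_surjective (x 0)
  have hunitary : (((v : Matrix (Fin D) (Fin D) ℂ) * ρ).trace • 1 : Matrix (Fin D) (Fin D) ℂ)
      ∈ Matrix.unitaryGroup (Fin D) ℂ := by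
    refine isClosed_unitary.mem_of_tendsto (h.tendsto_transferDual_iterate v)
      (Eventually.of_forall fun k => ?_)
    obtain ⟨w, -, hw⟩ := h.leftCanonical.exists_unitary_eq_transferDual_iterate hx hv k
    exact hw ▸ w.2
  have := h.nonempty
  obtain ⟨c, hc⟩ := exists_circle_coe_eq_of_smul_one_mem hunitary
  have hscalar := eq_trace_smul_one_of_norm_trace_eq_one h.posDef h.trace_eq_one
    (by rw [← hc, Circle.norm_coe])
  rw [← hv, QuotientGroup.eq_one_iff]
  exact ⟨c, Subtype.ext (by rw [coe_scalarUnitary, hc, ← hscalar])⟩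

theorem IsStationary.eq_of_forall_mem {ρ : Matrix (Fin D) (Fin D) ℂ} (h : IsStationary A ρ)
    {p : ℕ → ProjectiveUnitary σ} {x y : ℕ → ProjectiveUnitary (Fin D)}
    (hx : ∀ j, (p j, x j, x (j + 1)) ∈ projectiveIntertwiners A)
    (hy : ∀ j, (p j, y j, y (j + 1)) ∈ projectiveIntertwiners A) (i : ℕ) : x i = y i := by
  refine div_eq_one.1 (h.eq_one_of_forall_mem (x := fun j => x (i + j) / y (i + j)) fun j => ?_)
  simpa only [Prod.mk_div_mk, div_self', add_assoc] using div_mem (hx (i + j)) (hy (i + j))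

theorem IsStationary.eq_zpow_of_forall_mem {ρ : Matrix (Fin D) (Fin D) ℂ} (h : IsStationary A ρ)
    {p : ProjectiveUnitary σ} {b : ℤ} {x : ℕ → ProjectiveUnitary (Fin D)}
    (hx : ∀ j, (p ^ (b ^ j), x j, x (j + 1)) ∈ projectiveIntertwiners A) (j : ℕ) :
    x j = x 0 ^ (b ^ j) := by
  have hstep : ∀ j, x (j + 1) = x j ^ b := fun j =>
    h.eq_of_forall_mem (p := fun j => p ^ (b ^ (j + 1))) (x := fun j => x (j + 1))
      (y := fun j => x j ^ b) (fun j => hx (j + 1))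
      (fun j => by simpa only [Prod.pow_mk, ← zpow_mul, ← pow_succ] using zpow_mem (hx j) b) j
  induction j with
  | zero => rw [pow_zero, zpow_one]
  | succ j ih => rw [hstep, ih, ← zpow_mul, ← pow_succ]

end ProjectiveIntertwiners

section BondUnitaryClasses

variable {σ : Type*} [Fintype σ] [DecidableEq σ] {D r : ℕ} {A : Tensor σ D}
  {a : Fin r → ℤ} {U : Fin r → Matrix.unitaryGroup σ ℂ}

theorem eq_conjTranspose_mul_iff {m : Type*} [Fintype m] [DecidableEq m]
    {v : Matrix.unitaryGroup m ℂ} {X Y : Matrix m m ℂ} :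
    X = (v : Matrix m m ℂ)ᴴ * Y ↔ v * X = Y := by
  constructor
  · rintro rfl
    rw [← mul_assoc, ← Matrix.star_eq_conjTranspose, Unitary.mul_star_self_of_mem v.2, one_mul]
  · rintro rfl
    rw [← mul_assoc, ← Matrix.star_eq_conjTranspose, Unitary.star_mul_self_of_mem v.2, one_mul]

theorem pushesThrough_iff {v : Fin r → Matrix.unitaryGroup (Fin D) ℂ} :
    PushesThrough a U A v ↔ ∀ I j, ((U I : ProjectiveUnitary σ) ^ (a I ^ j),
      (v I : ProjectiveUnitary (Fin D)) ^ (a I ^ j),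
      (v I : ProjectiveUnitary (Fin D)) ^ (a I ^ (j + 1))) ∈ projectiveIntertwiners A := by
  refine forall_congr' fun I => forall_congr' fun j => ?_
  simp only [← QuotientGroup.mk_zpow]
  rw [mk_mem_projectiveIntertwiners_iff]
  refine exists_congr fun c => forall_congr' fun s => ?_
  rw [coe_scalarUnitary_mul, mul_smul_comm, mul_assoc, ← mul_smul_comm]
  exact eq_conjTranspose_mul_iff

theorem isPeriodic_iff {L : ℕ} {u : Matrix.unitaryGroup σ ℂ} {b : ℤ} :
    IsPeriodic L u b ↔ (u : ProjectiveUnitary σ) ^ (b ^ L) = u :=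
  eqPhase_iff_mk_eq_mk

theorem IsStationary.exists_pushesThrough {ρ : Matrix (Fin D) (Fin D) ℂ} (h : IsStationary A ρ)
    {L : ℕ} (hL : 0 < L) (hper : ∀ I, IsPeriodic L (U I) (a I)) (hsym : IsSymmetric L a U A) :
    ∃ v : Fin r → Matrix.unitaryGroup (Fin D) ℂ, PushesThrough a U A v := by
  have hseq : ∀ I, ∃ X : ℕ → Matrix.unitaryGroup (Fin D) ℂ,
      ∀ j, (U I ^ (a I ^ j), X j, X (j + 1)) ∈ intertwiners A := fun I =>
    h.exists_unitary_seq (u := fun j => U I ^ (a I ^ j)) hL (fun j => eqPhase_iff_mk_eq_mk.2 <| by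
      rw [QuotientGroup.mk_zpow, QuotientGroup.mk_zpow, add_comm, pow_add, zpow_mul,
        isPeriodic_iff.1 (hper I)]) (hsym I)
  choose X hX using hseq
  refine ⟨fun I => X I 0, pushesThrough_iff.2 fun I j => ?_⟩
  have hmem : ∀ j, ((U I : ProjectiveUnitary σ) ^ (a I ^ j), (X I j : ProjectiveUnitary (Fin D)),
      (X I (j + 1) : ProjectiveUnitary (Fin D))) ∈ projectiveIntertwiners A := fun j =>
    ⟨_, hX I j, rfl⟩
  have hpow := h.eq_zpow_of_forall_mem (x := fun j => X I j) hmem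
  rw [← hpow, ← hpow]
  exact hmem j

namespace PushesThrough

variable {ρ : Matrix (Fin D) (Fin D) ℂ} {v v' : Fin r → Matrix.unitaryGroup (Fin D) ℂ}

theorem mk_eq_mk (hv : PushesThrough a U A v) (hv' : PushesThrough a U A v')
    (h : IsStationary A ρ) (I : Fin r) : (v I : ProjectiveUnitary (Fin D)) = v' I := by
  simpa using h.eq_of_forall_mem (pushesThrough_iff.1 hv I) (pushesThrough_iff.1 hv' I) 0

theorem mk_pow_eq_one (hv : PushesThrough a U A v) (h : IsStationary A ρ) {I : Fin r} {N : ℕ}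
    (hU : (U I : ProjectiveUnitary σ) ^ N = 1) : (v I : ProjectiveUnitary (Fin D)) ^ N = 1 := by
  rw [← zpow_natCast] at hU ⊢
  have hmem : ∀ j, _ := fun j => zpow_mem (pushesThrough_iff.1 hv I j) N
  simp only [Prod.pow_mk, zpow_comm _ _ (N : ℤ), hU, one_zpow] at hmem
  simpa using h.eq_one_of_forall_mem hmem

theorem mk_commute (hv : PushesThrough a U A v) (h : IsStationary A ρ) {I J : Fin r}
    (hU : Commute (U I : ProjectiveUnitary σ) (U J)) :
    Commute (v I : ProjectiveUnitary (Fin D)) (v J) := by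
  have hI := pushesThrough_iff.1 hv I
  have hJ := pushesThrough_iff.1 hv J
  have hmem : ∀ j, _ := fun j => mul_mem (hJ j) (hI j)
  simp only [Prod.mk_mul_mk, ← ((hU.zpow_zpow _ _).eq)] at hmem
  simpa [commute_iff_eq] using h.eq_of_forall_mem (fun j => mul_mem (hI j) (hJ j)) hmem 0

theorem mul_eq_zpow_of_commutatorElement_eq (hv : PushesThrough a U A v) (hA : ∃ s, A s ≠ 0)
    {I J : Fin r} {c d : Circle} (hU : ⁅U I, U J⁆ = scalarUnitary σ c)
    (hd : ⁅v I, v J⁆ = scalarUnitary (Fin D) d) : c * d = d ^ (a I * a J) := by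
  have hmem : ∀ I, ∃ w : Matrix.unitaryGroup (Fin D) ℂ, (U I, v I, w) ∈ intertwiners A ∧
      (w : ProjectiveUnitary (Fin D)) = (v I ^ a I : Matrix.unitaryGroup (Fin D) ℂ) := fun I =>
    exists_mem_intertwiners <| by
      simpa only [pow_zero, zpow_one, zero_add, pow_one, QuotientGroup.mk_zpow]
        using pushesThrough_iff.1 hv I 0
  obtain ⟨w, hw, hvw⟩ := hmem I
  obtain ⟨w', hw', hvw'⟩ := hmem J
  have hcomm : (⁅U I, U J⁆, ⁅v I, v J⁆, ⁅w, w'⁆) ∈ intertwiners A := by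
    simpa only [commutatorElement_def, Prod.mk_mul_mk, Prod.inv_mk] using
      mul_mem (mul_mem (mul_mem hw hw') (inv_mem hw)) (inv_mem hw')
  rw [hU, hd, commutatorElement_eq_of_mk_eq range_scalarUnitary_le_center hvw hvw',
    commutatorElement_zpow_zpow_eq_scalarUnitary hd] at hcomm
  exact mul_eq_of_scalarUnitary_mem_intertwiners hA hcomm

theorem solvesBondEquation (hv : PushesThrough a U A v) (hA : ∃ s, A s ≠ 0) {I J : Fin r} {M : ℕ}
    [NeZero M] {n k : ℤ} (hU : ⁅U I, U J⁆ = scalarUnitary σ (rootPhase M n))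
    (hk : ⁅v I, v J⁆ = scalarUnitary (Fin D) (rootPhase M k)) :
    SolvesBondEquation M (a I * a J) n k := by
  have hphase := mul_eq_zpow_of_commutatorElement_eq hv hA hU hk
  rw [rootPhase_mul_rootPhase, rootPhase_zpow, rootPhase_eq_rootPhase_iff] at hphase
  calc k * (a I * a J - 1) = k * (a I * a J) - k := by ring
    _ ≡ n + k - k [ZMOD M] := (hphase.sub_right k).symm
    _ = n := add_sub_cancel_right n k

end PushesThrough

end BondUnitaryClasses

section Gauge

variable {σ : Type*} {D : ℕ}

/-- The gauge transform `A^s ↦ c P A^s P⁻¹`, including a rescaling by `c`. -/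
noncomputable def gaugeTransform (c : ℂ) (P : (Matrix (Fin D) (Fin D) ℂ)ˣ) (A : Tensor σ D) :
    Tensor σ D :=
  fun s => c • (P.val * A s * P⁻¹.val)

theorem amplitude_gaugeTransform (c : ℂ) (P : (Matrix (Fin D) (Fin D) ℂ)ˣ) (A : Tensor σ D)
    (n : ℕ) (s : Fin n → σ) :
    amplitude (gaugeTransform c P A) n s = c ^ n * amplitude A n s := by
  have hconj : (List.ofFn fun j => P.val * A (s j) * P⁻¹.val).prod
      = P.val * (List.ofFn fun j => A (s j)).prod * P⁻¹.val := by
    simpa only [List.map_ofFn, ConjAct.units_smul_def, Function.comp_def,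
      ConjAct.ofConjAct_toConjAct]
      using (List.smul_prod' (r := ConjAct.toConjAct P) (l := List.ofFn fun j => A (s j))).symm
  simp only [amplitude, gaugeTransform]
  rw [list_prod_ofFn_smul, hconj, Matrix.trace_smul, Matrix.trace_units_conj, Finset.prod_const,
    Finset.card_univ, Fintype.card_fin, smul_eq_mul]

variable [Fintype σ]

theorem IsSymmetric.gauge [DecidableEq σ] {r L : ℕ} {a : Fin r → ℤ}
    {U : Fin r → Matrix.unitaryGroup σ ℂ} {A : Tensor σ D} (h : IsSymmetric L a U A) (c : ℂ)
    (P : (Matrix (Fin D) (Fin D) ℂ)ˣ) : IsSymmetric L a U (gaugeTransform c P A) := by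
  intro I m hm
  obtain ⟨φ, hφ⟩ := h I m hm
  refine ⟨φ, fun s => ?_⟩
  simp only [amplitude_gaugeTransform, mul_left_comm _ (c ^ (m * L)), chainOp, ← Finset.mul_sum]
  rw [← hφ, chainOp]

theorem transfer_gaugeTransform (c : ℂ) (P : (Matrix (Fin D) (Fin D) ℂ)ˣ) (A : Tensor σ D)
    (X : Matrix (Fin D) (Fin D) ℂ) :
    transfer (gaugeTransform c P A) (P.val * X * P.valᴴ)
      = (star c * c) • (P.val * transfer A X * P.valᴴ) := by
  simp only [transfer, gaugeTransform, ← Matrix.star_eq_conjTranspose, star_smul, star_mul,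
    Finset.mul_sum, Finset.sum_mul, Finset.smul_sum, smul_mul_assoc, mul_smul_comm, smul_smul,
    ← Units.coe_star, star_inv, mul_assoc, Units.inv_mul_cancel_left, Units.mul_inv_cancel_left]

theorem transferDual_gaugeTransform (c : ℂ) (P : (Matrix (Fin D) (Fin D) ℂ)ˣ) (A : Tensor σ D)
    (X : Matrix (Fin D) (Fin D) ℂ) :
    transferDual (gaugeTransform c P A) (P⁻¹.valᴴ * X * P⁻¹.val)
      = (star c * c) • (P⁻¹.valᴴ * transferDual A X * P⁻¹.val) := by
  simp only [transferDual, gaugeTransform, ← Matrix.star_eq_conjTranspose, star_smul, star_mul,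
    Finset.mul_sum, Finset.sum_mul, Finset.smul_sum, smul_mul_assoc, mul_smul_comm, smul_smul,
    ← Units.coe_star, star_inv, mul_assoc, Units.inv_mul_cancel_left, Units.mul_inv_cancel_left,
    mul_comm c]

theorem IsInjective.gauge {A : Tensor σ D} (hA : IsInjective A) {c : ℂ} (hc : c ≠ 0)
    (P : (Matrix (Fin D) (Fin D) ℂ)ˣ) : IsInjective (gaugeTransform c P A) := by
  obtain ⟨hD, lam, ρ, l, hlam, hρ, hl, hρfixed, hlfixed, hspec⟩ := hA
  obtain ⟨κ, hκ, hcκ⟩ : ∃ κ : ℝ, 0 < κ ∧ star c * c = κ :=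
    ⟨‖c‖ ^ 2, by positivity, by simp [Complex.conj_mul']⟩
  have hκ0 : (κ : ℂ) ≠ 0 := by exact_mod_cast hκ.ne'
  refine ⟨hD, κ * lam, P.val * ρ * P.valᴴ, P⁻¹.valᴴ * l * P⁻¹.val, mul_pos hκ hlam,
    (Matrix.IsUnit.posDef_star_right_conjugate_iff P.isUnit).2 hρ,
    (Matrix.IsUnit.posDef_star_left_conjugate_iff P⁻¹.isUnit).2 hl, ?_, ?_, fun μ X hX hμ => ?_⟩
  · rw [transfer_gaugeTransform, hρfixed, hcκ, mul_smul_comm, smul_mul_assoc, smul_smul,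
      Complex.ofReal_mul]
  · rw [transferDual_gaugeTransform, hlfixed, hcκ, mul_smul_comm, smul_mul_assoc, smul_smul,
      Complex.ofReal_mul]
  obtain ⟨Y, rfl⟩ : ∃ Y, P.val * Y * P.valᴴ = X :=
    ⟨P⁻¹.val * X * (star P)⁻¹.val, by
      rw [← Matrix.star_eq_conjTranspose, ← Units.coe_star]
      simp only [mul_assoc, Units.mul_inv_cancel_left, Units.inv_mul, mul_one]⟩
  have hY : Y ≠ 0 := by
    rintro rfl
    simp at hX
  have hYμ : transfer A Y = ((κ : ℂ)⁻¹ * μ) • Y := by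
    have hconj : P.val * ((κ : ℂ) • transfer A Y) * (star P).val
        = P.val * (μ • Y) * (star P).val := by
      simpa only [transfer_gaugeTransform, hcκ, mul_smul_comm, smul_mul_assoc, Units.coe_star,
        Matrix.star_eq_conjTranspose] using hμ
    rw [Units.mul_left_inj, Units.mul_right_inj] at hconj
    rw [← smul_smul, ← hconj, inv_smul_smul₀ hκ0]
  rcases hspec _ Y hY hYμ with h | ⟨h, d, rfl⟩
  · left
    rwa [norm_mul, norm_inv, Complex.norm_of_nonneg hκ.le, inv_mul_lt_iff₀ hκ] at h
  · right
    refine ⟨?_, d, by rw [mul_smul_comm, smul_mul_assoc]⟩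
    rw [Complex.ofReal_mul, ← h, mul_inv_cancel_left₀ hκ0]

theorem IsInjective.exists_isLeftCanonical_gaugeTransform {A : Tensor σ D} (hA : IsInjective A) :
    ∃ (c : ℂ) (P : (Matrix (Fin D) (Fin D) ℂ)ˣ),
      IsInjective (gaugeTransform c P A) ∧ IsLeftCanonical (gaugeTransform c P A) := by
  obtain ⟨-, lam, -, l, hlam, -, hl, -, hlfixed, -⟩ := id hA
  obtain ⟨P, rfl⟩ := exists_units_conjTranspose_mul_self hl
  have hsqrt : (Real.sqrt lam : ℂ) ≠ 0 := by exact_mod_cast (Real.sqrt_pos.2 hlam).ne'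
  have hscale : star (Real.sqrt lam : ℂ)⁻¹ * (Real.sqrt lam : ℂ)⁻¹ * lam = 1 := by
    rw [Complex.star_def, ← Complex.ofReal_inv, Complex.conj_ofReal]
    norm_cast
    rw [← mul_inv, Real.mul_self_sqrt hlam.le, inv_mul_cancel₀ hlam.ne']
  have hone : P⁻¹.valᴴ * (P.valᴴ * P.val) * P⁻¹.val = 1 := by
    simp only [← Matrix.star_eq_conjTranspose, ← Units.coe_star, star_inv,
      Units.inv_mul_cancel_left, Units.mul_inv]
  refine ⟨(Real.sqrt lam : ℂ)⁻¹, P, hA.gauge (inv_ne_zero hsqrt) P, ?_⟩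
  have hdual := transferDual_gaugeTransform (Real.sqrt lam : ℂ)⁻¹ P A (P.valᴴ * P.val)
  rw [hlfixed, mul_smul_comm, smul_mul_assoc, smul_smul, hone, hscale, one_smul] at hdual
  simpa only [IsLeftCanonical, transferDual, mul_one] using hdual

end Gauge

section ProductState

theorem exists_commonEigenvector {K V ι : Type*} [Field K] [IsAlgClosed K] [AddCommGroup V]
    [Module K V] [FiniteDimensional K V] [Nontrivial V] {f : ι → Module.End K V}
    (hf : ∀ i j, Commute (f i) (f j)) : ∃ x : V, x ≠ 0 ∧ ∀ i, ∃ μ : K, f i x = μ • x := by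
  obtain ⟨W, ⟨hW, hinv⟩, hmin⟩ := exists_minimal_of_wellFoundedLT
    (fun W : Submodule K V => W ≠ ⊥ ∧ ∀ i, ∀ x ∈ W, f i x ∈ W)
    ⟨⊤, top_ne_bot, fun _ _ _ => Submodule.mem_top⟩
  obtain ⟨x, hxW, hx⟩ := W.ne_bot_iff.1 hW
  refine ⟨x, hx, fun i => ?_⟩
  have : Nontrivial W := Submodule.nontrivial_iff_ne_bot.2 hW
  obtain ⟨μ, hμ⟩ := Module.End.exists_eigenvalue ((f i).restrict (hinv i))
  obtain ⟨y, hy⟩ := hμ.exists_hasEigenvector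
  have hne : W ⊓ (f i).eigenspace μ ≠ ⊥ :=
    (Submodule.ne_bot_iff _).2 ⟨y, ⟨y.2, Module.End.mem_eigenspace_iff.2
      (congrArg Subtype.val hy.apply_eq_smul)⟩, fun h0 => hy.2 (Subtype.ext h0)⟩
  have hinv' : ∀ j, ∀ z ∈ W ⊓ (f i).eigenspace μ, f j z ∈ W ⊓ (f i).eigenspace μ :=
    fun j z hz => ⟨hinv j z hz.1,
      Module.End.mapsTo_genEigenspace_of_comm (hf i j) μ 1 hz.2⟩
  exact ⟨μ, Module.End.mem_eigenspace_iff.1 (hmin ⟨hne, hinv'⟩ inf_le_left hxW).2⟩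

variable {σ : Type*}

/-- The bond-dimension-one tensor whose MPS is the product state `x ⊗ ⋯ ⊗ x`. -/
def productTensor (x : σ → ℂ) : Tensor σ 1 :=
  fun s => x s • 1

variable [Fintype σ]

theorem transfer_productTensor {x : σ → ℂ} (hx : star x ⬝ᵥ x = 1) :
    transfer (productTensor x) = id := by
  funext X
  simp only [dotProduct, Pi.star_apply] at hx
  simp only [transfer, productTensor, Matrix.conjTranspose_smul, Matrix.conjTranspose_one,
    smul_mul_assoc, mul_smul_comm, one_mul, mul_one, smul_smul, ← Finset.sum_smul, hx, one_smul,
    id_eq]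

theorem transferDual_productTensor {x : σ → ℂ} (hx : star x ⬝ᵥ x = 1) :
    transferDual (productTensor x) = id := by
  funext X
  simp only [dotProduct, Pi.star_apply, mul_comm (star _)] at hx
  simp only [transferDual, productTensor, Matrix.conjTranspose_smul, Matrix.conjTranspose_one,
    smul_mul_assoc, mul_smul_comm, one_mul, mul_one, smul_smul, ← Finset.sum_smul, hx, one_smul,
    id_eq]

theorem isLeftCanonical_productTensor {x : σ → ℂ} (hx : star x ⬝ᵥ x = 1) :
    IsLeftCanonical (productTensor x) := by
  simpa only [IsLeftCanonical, transferDual, mul_one, id_eq]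
    using congrFun (transferDual_productTensor hx) 1

theorem isInjective_productTensor {x : σ → ℂ} (hx : star x ⬝ᵥ x = 1) :
    IsInjective (productTensor x) := by
  refine ⟨one_pos, 1, 1, 1, one_pos, Matrix.PosDef.one, Matrix.PosDef.one, ?_, ?_,
    fun μ X hX h => Or.inr ⟨?_, X 0 0, ?_⟩⟩
  · rw [transfer_productTensor hx, id_eq, Complex.ofReal_one, one_smul]
  · rw [transferDual_productTensor hx, id_eq, Complex.ofReal_one, one_smul]
  · rw [transfer_productTensor hx, id_eq] at h
    rw [Complex.ofReal_one]
    exact smul_left_injective ℂ hX (by simpa only [one_smul] using h.symm)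
  · ext i j
    simp [Subsingleton.elim i 0, Subsingleton.elim j 0]

theorem act_productTensor (u : Matrix σ σ ℂ) (x : σ → ℂ) :
    act u (productTensor x) = productTensor (u *ᵥ x) := by
  funext s
  simp only [act, productTensor, smul_smul, ← Finset.sum_smul, Matrix.mulVec, dotProduct]

theorem exists_smul_dotProduct_eq_one {x : σ → ℂ} (hx : x ≠ 0) :
    ∃ t : ℂ, star (t • x) ⬝ᵥ (t • x) = 1 := by
  obtain ⟨κ, hκ, hxκ⟩ : ∃ κ : ℝ, 0 < κ ∧ (κ : ℂ) = star x ⬝ᵥ x :=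
    RCLike.pos_iff_exists_ofReal.1 (Matrix.dotProduct_star_self_pos_iff.2 hx)
  refine ⟨(Real.sqrt κ : ℂ)⁻¹, ?_⟩
  rw [star_smul, smul_dotProduct, dotProduct_smul, ← hxκ, smul_eq_mul, smul_eq_mul, star_inv₀,
    Complex.star_def, Complex.conj_ofReal, ← mul_assoc, ← mul_inv, ← Complex.ofReal_mul,
    Real.mul_self_sqrt hκ.le, inv_mul_cancel₀ (by exact_mod_cast hκ.ne')]

variable [DecidableEq σ]

theorem dotProduct_unitary_mulVec (u : Matrix.unitaryGroup σ ℂ) (x : σ → ℂ) :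
    star (u.val *ᵥ x) ⬝ᵥ (u.val *ᵥ x) = star x ⬝ᵥ x := by
  rw [Matrix.star_mulVec, Matrix.dotProduct_mulVec, Matrix.vecMul_vecMul,
    ← Matrix.star_eq_conjTranspose, Unitary.star_mul_self_of_mem u.2, Matrix.vecMul_one]

theorem exists_circle_mulVec_eq_smul {u : Matrix.unitaryGroup σ ℂ} {x : σ → ℂ}
    (hx : star x ⬝ᵥ x = 1) {μ : ℂ} (h : u.val *ᵥ x = μ • x) :
    ∃ φ : Circle, u.val *ᵥ x = (φ : ℂ) • x := by
  have hμ := dotProduct_unitary_mulVec u x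
  rw [h, star_smul, smul_dotProduct, dotProduct_smul, hx, smul_eq_mul, smul_eq_mul, mul_one,
    Complex.star_def, Complex.conj_mul'] at hμ
  have hnorm : ‖μ‖ = 1 := (pow_eq_one_iff_of_nonneg (norm_nonneg μ) two_ne_zero).1
    (by exact_mod_cast hμ)
  exact ⟨⟨μ, mem_sphere_zero_iff_norm.2 hnorm⟩, h⟩

theorem exists_unit_commonEigenvector [Nonempty σ] {ι : Type*} {U : ι → Matrix.unitaryGroup σ ℂ}
    (hU : ∀ i j, Commute (U i) (U j)) :
    ∃ x : σ → ℂ, star x ⬝ᵥ x = 1 ∧ ∀ i, ∃ φ : Circle, (U i).val *ᵥ x = (φ : ℂ) • x := by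
  obtain ⟨x, hx, hμ⟩ := exists_commonEigenvector (f := fun i => Matrix.toLinAlgEquiv' (U i).val)
    fun i j => ((hU i j).map (Matrix.unitaryGroup σ ℂ).subtype).map Matrix.toLinAlgEquiv'
  obtain ⟨t, ht⟩ := exists_smul_dotProduct_eq_one hx
  refine ⟨t • x, ht, fun i => ?_⟩
  obtain ⟨μ, h⟩ := hμ i
  refine exists_circle_mulVec_eq_smul (μ := μ) ht ?_
  rw [Matrix.mulVec_smul, smul_comm μ t, ← Matrix.toLinAlgEquiv'_apply, h]

theorem mem_intertwiners_productTensor {u : Matrix.unitaryGroup σ ℂ} {x : σ → ℂ} {φ : Circle}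
    (h : u.val *ᵥ x = (φ : ℂ) • x) :
    (u, 1, scalarUnitary (Fin 1) φ) ∈ intertwiners (productTensor x) := by
  intro s
  simp [act_productTensor, h, productTensor, coe_scalarUnitary, smul_smul]

section EigenProduct

variable {r : ℕ} {U : Fin r → Matrix.unitaryGroup σ ℂ} {x : σ → ℂ}

theorem zpow_mem_intertwiners_productTensor {u : Matrix.unitaryGroup σ ℂ} {φ : Circle}
    (h : u.val *ᵥ x = (φ : ℂ) • x) (k : ℤ) :
    (u ^ k, 1, scalarUnitary (Fin 1) (φ ^ k)) ∈ intertwiners (productTensor x) := by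
  simpa only [Prod.pow_mk, one_zpow, map_zpow] using
    zpow_mem (mem_intertwiners_productTensor h) k

theorem pushesThrough_one_productTensor (hU : ∀ I, ∃ φ : Circle, (U I).val *ᵥ x = (φ : ℂ) • x)
    (a : Fin r → ℤ) : PushesThrough a U (productTensor x) 1 := by
  refine pushesThrough_iff.2 fun I j => ?_
  obtain ⟨φ, hφ⟩ := hU I
  refine ⟨_, zpow_mem_intertwiners_productTensor hφ (a I ^ j), ?_⟩
  simp [mk_scalarUnitary]

theorem isSymmetric_productTensor (hU : ∀ I, ∃ φ : Circle, (U I).val *ᵥ x = (φ : ℂ) • x)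
    (L : ℕ) (a : Fin r → ℤ) : IsSymmetric L a U (productTensor x) := by
  intro I m _
  obtain ⟨φ, hφ⟩ := hU I
  have hact : ∀ j s, act (siteOp (U I) (a I) j) (productTensor x) s
      = ((φ ^ (a I ^ j) : Circle) : ℂ) • productTensor x s := fun j s => by
    rw [siteOp, ← one_mul (act _ _ s)]
    refine (zpow_mem_intertwiners_productTensor hφ (a I ^ j) s).trans ?_
    rw [coe_scalarUnitary, mul_smul_comm, mul_one]
  refine ⟨∏ j : Fin (m * L), φ ^ (a I ^ ((j : ℕ) % L)), fun s => ?_⟩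
  simp only [chainOp_amplitude, hact]
  rw [list_prod_ofFn_smul, Matrix.trace_smul, smul_eq_mul, amplitude]
  congr 1
  exact (map_prod Circle.coeHom (fun j : Fin (m * L) => φ ^ (a I ^ ((j : ℕ) % L))) _).symm

end EigenProduct

theorem not_sptLSMObstruction_of_commute [Nonempty σ] {r : ℕ} (L : ℕ) (N : Fin r → ℕ)
    (a : Fin r → ℤ) {U : Fin r → Matrix.unitaryGroup σ ℂ} (hU : ∀ I J, Commute (U I) (U J)) :
    ¬ SPTLSMObstruction L N a U := by
  obtain ⟨x, hx, heig⟩ := exists_unit_commonEigenvector hU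
  have hbond : ∀ g, bondOp N a (1 : Fin r → Matrix.unitaryGroup (Fin 1) ℂ) 0 g = 1 := fun g => by
    simp [bondOp]
  exact fun h => h 1 (productTensor x) (isInjective_productTensor hx)
    (isLeftCanonical_productTensor hx) (isSymmetric_productTensor heig L a) 1
    (pushesThrough_one_productTensor heig a) 0 1 (fun g h => by simp [hbond])
    ⟨1, fun g h => by simp⟩

end ProductState

section ExponentialSystem

variable {σ : Type*} [Fintype σ] [DecidableEq σ] {r L : ℕ} {N : Fin r → ℕ} {a : Fin r → ℤ}
  {n : Fin r → Fin r → ℤ} {U : Fin r → Matrix.unitaryGroup σ ℂ}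

/-- On-site generators `U_I` of a projective action of `∏ ℤ/N_I`, with commutators prescribed by
`n_{IJ}`, whose exponential symmetries `⊗_j U_I ^ (a_I ^ j)` fit on periodic chains of `L` sites. -/
structure IsExponentialSystem (L : ℕ) (N : Fin r → ℕ) (a : Fin r → ℤ) (n : Fin r → Fin r → ℤ)
    (U : Fin r → Matrix.unitaryGroup σ ℂ) : Prop where
  length_pos : 0 < L
  order_pos : ∀ I, 0 < N I
  pow_order : ∀ I, EqPhase ((U I ^ N I : Matrix.unitaryGroup σ ℂ) : Matrix σ σ ℂ) 1
  periodic : ∀ I, IsPeriodic L (U I) (a I)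
  commutator : ∀ I J, I < J → (U I : Matrix σ σ ℂ) * (U J : Matrix σ σ ℂ) =
    (rootPhase (Nat.gcd (N I) (N J)) (n I J) : ℂ) • ((U J : Matrix σ σ ℂ) * (U I : Matrix σ σ ℂ))

namespace IsExponentialSystem

theorem neZero_order (h : IsExponentialSystem L N a n U) (I : Fin r) : NeZero (N I) :=
  ⟨(h.order_pos I).ne'⟩

theorem neZero_gcd (h : IsExponentialSystem L N a n U) (I J : Fin r) :
    NeZero ((N I).gcd (N J)) :=
  ⟨Nat.gcd_ne_zero_left (h.order_pos I).ne'⟩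

theorem mk_pow_order (h : IsExponentialSystem L N a n U) (I : Fin r) :
    (U I : ProjectiveUnitary σ) ^ N I = 1 :=
  eqPhase_iff_mk_eq_mk (y := 1).1 (h.pow_order I)

theorem commutatorElement_eq (h : IsExponentialSystem L N a n U) {I J : Fin r} (hIJ : I < J) :
    ⁅U I, U J⁆ = scalarUnitary σ (rootPhase ((N I).gcd (N J)) (n I J)) :=
  commutatorElement_eq_scalarUnitary_iff.2 (h.commutator I J hIJ)

theorem mk_commute (h : IsExponentialSystem L N a n U) (I J : Fin r) :
    Commute (U I : ProjectiveUnitary σ) (U J) := by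
  have hlt : ∀ {I J : Fin r}, I < J → Commute (U I : ProjectiveUnitary σ) (U J) :=
    fun {I J} hIJ => mk_eq_mk_iff_exists_scalarUnitary_mul.2
      ⟨_, eq_scalarUnitary_mul_iff.2 (h.commutator I J hIJ)⟩
  rcases lt_trichotomy I J with hIJ | rfl | hIJ
  · exact hlt hIJ
  · exact Commute.refl _
  · exact (hlt hIJ).symm

theorem exists_pushesThrough (h : IsExponentialSystem L N a n U) {D : ℕ} {A : Tensor σ D}
    (hinj : IsInjective A) (hcan : IsLeftCanonical A) (hsym : IsSymmetric L a U A) :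
    ∃ v : Fin r → Matrix.unitaryGroup (Fin D) ℂ, PushesThrough a U A v := by
  obtain ⟨ρ, hρ⟩ := exists_isStationary hinj hcan
  exact hρ.exists_pushesThrough h.length_pos h.periodic hsym

theorem exists_hasCocycle_bondOp (h : IsExponentialSystem L N a n U) {D : ℕ} {A : Tensor σ D}
    (hinj : IsInjective A) (hcan : IsLeftCanonical A) {v : Fin r → Matrix.unitaryGroup (Fin D) ℂ}
    (hv : PushesThrough a U A v) (j : ℕ) : ∃ ω, HasCocycle (bondOp N a v j) ω := by
  obtain ⟨ρ, hρ⟩ := exists_isStationary hinj hcan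
  have := h.neZero_order
  exact exists_hasCocycle <| mk_bondOp_mul_mk_bondOp a
    (fun I => hv.mk_pow_eq_one hρ (h.mk_pow_order I))
    (fun I J => hv.mk_commute hρ (h.mk_commute I J)) j

theorem exists_isBondClass (h : IsExponentialSystem L N a n U) {D : ℕ} {A : Tensor σ D}
    (hinj : IsInjective A) (hcan : IsLeftCanonical A) (hsym : IsSymmetric L a U A) {I J : Fin r}
    (hIJ : I < J) :
    ∃ k : ℤ, SolvesBondEquation ((N I).gcd (N J)) (a I * a J) (n I J) k ∧
      ∀ v : Fin r → Matrix.unitaryGroup (Fin D) ℂ, PushesThrough a U A v →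
        IsBondClass N a v I J ((N I).gcd (N J)) k := by
  obtain ⟨ρ, hρ⟩ := exists_isStationary hinj hcan
  have := hρ.nonempty
  have := h.neZero_order
  have := h.neZero_gcd
  have hpow : ∀ {v}, PushesThrough a U A v → ∀ I, (v I : ProjectiveUnitary (Fin D)) ^ N I = 1 :=
    fun hv I => hv.mk_pow_eq_one hρ (h.mk_pow_order I)
  obtain ⟨v, hv⟩ := hρ.exists_pushesThrough h.length_pos h.periodic hsym
  obtain ⟨k, hk⟩ := exists_commutatorElement_eq_rootPhase (hpow hv I) (hpow hv J)
    (hv.mk_commute hρ (h.mk_commute I J))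
  refine ⟨k, hv.solvesBondEquation hρ.exists_ne_zero (h.commutatorElement_eq hIJ) hk,
    fun w hw => ?_⟩
  have hwv := hw.mk_eq_mk hv hρ
  refine isBondClass_of_commutatorElement_eq a (hpow hw I) (hpow hw J) ?_
  rw [← hk]
  exact commutatorElement_eq_of_mk_eq range_scalarUnitary_le_center (hwv I) (hwv J)

theorem lsmObstruction (h : IsExponentialSystem L N a n U) {I J : Fin r} (hIJ : I < J)
    (hn : ¬ (Int.gcd (a I * a J - 1) ((N I).gcd (N J) : ℕ) : ℤ) ∣ n I J) :
    LSMObstruction L a U := by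
  intro D A hA hsym
  obtain ⟨c, P, hinj, hcan⟩ := hA.exists_isLeftCanonical_gaugeTransform
  obtain ⟨k, hk, -⟩ := h.exists_isBondClass hinj hcan (hsym.gauge c P) hIJ
  exact hn (exists_solvesBondEquation_iff.1 ⟨k, hk⟩)

theorem mul_pow_modEq [Nonempty σ] (h : IsExponentialSystem L N a n U) {I J : Fin r}
    (hIJ : I < J) : n I J * (a I * a J) ^ L ≡ n I J [ZMOD (N I).gcd (N J)] := by
  have := h.neZero_gcd
  exact mul_pow_modEq_of_isPeriodic (h.periodic I) (h.periodic J) (h.commutatorElement_eq hIJ)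

theorem sptLSMObstruction (h : IsExponentialSystem L N a n U) {I J : Fin r} (hIJ : I < J)
    (hn : ¬ (((N I).gcd (N J) : ℕ) : ℤ) ∣ n I J) : SPTLSMObstruction L N a U := by
  intro D A hinj hcan hsym v hv j ω hω htriv
  obtain ⟨ρ, hρ⟩ := exists_isStationary hinj hcan
  have : Nonempty σ := hρ.exists_ne_zero.nonempty
  have := h.neZero_gcd
  obtain ⟨k, hk, hclass⟩ := h.exists_isBondClass hinj hcan hsym hIJ
  have hphase : rootPhase ((N I).gcd (N J)) (k * (a I * a J) ^ j) = 1 := by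
    rw [← (hclass v hv j).2 ω hω, htriv.mul_inv_eq_one]
  exact hn (hk.dvd_of_dvd_mul_pow h.length_pos (h.mul_pow_modEq hIJ)
    (rootPhase_eq_one_iff.1 hphase))

theorem commute_of_dvd (h : IsExponentialSystem L N a n U)
    (hn : ∀ I J, I < J → (((N I).gcd (N J) : ℕ) : ℤ) ∣ n I J) (I J : Fin r) :
    Commute (U I) (U J) := by
  have hlt : ∀ {I J : Fin r}, I < J → Commute (U I) (U J) := fun {I J} hIJ => by
    have := h.neZero_gcd
    rw [← commutatorElement_eq_one_iff_commute, h.commutatorElement_eq hIJ,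
      rootPhase_eq_one_iff.2 (hn I J hIJ), map_one]
  rcases lt_trichotomy I J with hIJ | rfl | hIJ
  · exact hlt hIJ
  · exact Commute.refl _
  · exact (hlt hIJ).symm

theorem sptLSMObstruction_iff [Nonempty σ] (h : IsExponentialSystem L N a n U) :
    SPTLSMObstruction L N a U ↔ ∃ I J, I < J ∧ ¬ (((N I).gcd (N J) : ℕ) : ℤ) ∣ n I J := by
  refine ⟨fun hspt => ?_, fun ⟨I, J, hIJ, hn⟩ => h.sptLSMObstruction hIJ hn⟩
  by_contra! hn
  exact not_sptLSMObstruction_of_commute L N a (h.commute_of_dvd hn) hspt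

end IsExponentialSystem

end ExponentialSystem

section QuditChain

variable (N : ℕ) [NeZero N]

theorem shift_pow_apply (k : ℕ) (s t : ZMod N) :
    ((shift N ^ k : Matrix.unitaryGroup (ZMod N) ℂ) : Matrix (ZMod N) (ZMod N) ℂ) s t
      = if s = t + k then 1 else 0 := by
  induction k generalizing s with
  | zero => simp [Matrix.one_apply]
  | succ k ih =>
    have hshift : ∀ x, (shift N : Matrix (ZMod N) (ZMod N) ℂ) s x = if s = x + 1 then 1 else 0 :=
      fun _ => rfl
    rw [pow_succ', Matrix.UnitaryGroup.mul_apply, Matrix.mul_apply,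
      Finset.sum_eq_single (t + k) (fun x _ hx => by rw [ih, if_neg hx, mul_zero]) (by simp),
      hshift, ih, if_pos rfl, mul_one, Nat.cast_succ, add_assoc]

theorem shift_pow_self : shift N ^ N = 1 :=
  Subtype.ext (Matrix.ext fun s t => by rw [shift_pow_apply]; simp [Matrix.one_apply])

theorem clock_pow_self : clock N ^ N = 1 := by
  have hphase : ∀ s : ZMod N, (rootPhase N (s.val : ℤ) : ℂ) ^ N = 1 := fun s => by
    rw [← Circle.coe_pow, ← zpow_natCast, rootPhase_zpow,
      rootPhase_eq_one_iff.2 (dvd_mul_left _ _), Circle.coe_one]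
  refine Subtype.ext ?_
  change clockMatrix N ^ N = 1
  rw [clockMatrix, Matrix.diagonal_pow, ← Matrix.diagonal_one]
  exact congrArg _ (funext hphase)

theorem commutatorElement_clock_shift :
    ⁅clock N, shift N⁆ = scalarUnitary (ZMod N) (rootPhase N 1) := by
  rw [commutatorElement_eq_scalarUnitary_iff]
  ext s t
  simp only [clock, shift, clockMatrix, shiftMatrix, Matrix.diagonal_mul, Matrix.mul_diagonal,
    Matrix.smul_apply, Matrix.of_apply, smul_eq_mul]
  by_cases hst : s = t + 1
  · rw [if_pos hst, mul_one, one_mul, ← Circle.coe_mul, rootPhase_mul_rootPhase, hst]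
    refine congrArg _ (rootPhase_eq_rootPhase_iff.2 ?_)
    rw [← ZMod.intCast_eq_intCast_iff]
    push_cast
    rw [ZMod.natCast_zmod_val, ZMod.natCast_zmod_val, add_comm]
  · rw [if_neg hst, mul_zero, zero_mul, mul_zero]

variable {N} {a b n : ℤ} {L : ℕ}

theorem isExponentialSystem_quditGen (hL : 0 < L) (hX : IsPeriodic L (shift N) a)
    (hZ : IsPeriodic L (clock N ^ n) b) :
    IsExponentialSystem L (fun _ : Fin 2 => N) ![b, a] (fun _ _ => n) (quditGen N n) where
  length_pos := hL
  order_pos _ := NeZero.pos N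
  pow_order := by
    refine Fin.forall_fin_two.2 ⟨?_, ?_⟩ <;> refine eqPhase_iff_mk_eq_mk (y := 1).2 (congrArg _ ?_)
    · change (clock N ^ n) ^ N = 1
      rw [← zpow_natCast, zpow_comm, zpow_natCast, clock_pow_self, one_zpow]
    · exact shift_pow_self N
  periodic := Fin.forall_fin_two.2 ⟨hZ, hX⟩
  commutator I J hIJ := by
    obtain ⟨rfl, rfl⟩ : I = 0 ∧ J = 1 := by omega
    have hcomm := commutatorElement_zpow_zpow_eq_scalarUnitary (commutatorElement_clock_shift N) n 1
    rw [rootPhase_zpow, one_mul, mul_one, zpow_one] at hcomm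
    rw [Nat.gcd_self]
    exact commutatorElement_eq_scalarUnitary_iff.1 hcomm

end QuditChain

end ModulatedMPS

theorem mainTheorem6_general :
    (∀ (M : ℕ) (q n : ℤ), 0 < M →
      ((∃ k : ℤ, SolvesBondEquation M q n k) ↔ (Int.gcd (q - 1) M : ℤ) ∣ n) ∧
      ((Int.gcd (q - 1) M : ℤ) ∣ n →
        (∃ u : ℤ, u * ((q - 1) / (Int.gcd (q - 1) M : ℤ)) ≡ 1
          [ZMOD (M : ℤ) / (Int.gcd (q - 1) M : ℤ)]) ∧
        ∀ u : ℤ, u * ((q - 1) / (Int.gcd (q - 1) M : ℤ)) ≡ 1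
          [ZMOD (M : ℤ) / (Int.gcd (q - 1) M : ℤ)] →
          ∀ k : ℤ, SolvesBondEquation M q n k ↔
            ∃! τ : ℕ, τ < Int.gcd (q - 1) M ∧
              k ≡ n / (Int.gcd (q - 1) M : ℤ) * u + τ * ((M : ℤ) / (Int.gcd (q - 1) M : ℤ))
                [ZMOD (M : ℤ)]) ∧
      ((∀ k : ℤ, SolvesBondEquation M q n k → ¬ (M : ℤ) ∣ k) ↔ ¬ (M : ℤ) ∣ n)) ∧
    (∀ (N : ℕ) [NeZero N] (a b n : ℤ) (L : ℕ), 0 < L → IsPeriodic L (shift N) a →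
      IsPeriodic L (clock N ^ n) b →
      (∀ (D : ℕ) (A : Tensor (ZMod N) D), IsInjective A → IsLeftCanonical A →
        IsSymmetric L ![b, a] (quditGen N n) A →
        (∃ v : Fin 2 → Matrix.unitaryGroup (Fin D) ℂ,
          PushesThrough ![b, a] (quditGen N n) A v) ∧
        (∀ v : Fin 2 → Matrix.unitaryGroup (Fin D) ℂ,
          PushesThrough ![b, a] (quditGen N n) A v →
          ∀ j : ℕ, ∃ ω, HasCocycle (bondOp (fun _ : Fin 2 => N) ![b, a] v j) ω) ∧
        ∃ k : ℤ, SolvesBondEquation N (a * b) n k ∧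
          ∀ v : Fin 2 → Matrix.unitaryGroup (Fin D) ℂ,
            PushesThrough ![b, a] (quditGen N n) A v →
            IsBondClass (fun _ : Fin 2 => N) ![b, a] v 0 1 N k) ∧
      (¬ (Int.gcd (a * b - 1) N : ℤ) ∣ n → LSMObstruction L ![b, a] (quditGen N n)) ∧
      ((∀ k : ℤ, SolvesBondEquation N (a * b) n k → ¬ (N : ℤ) ∣ k) →
        SPTLSMObstruction L (fun _ : Fin 2 => N) ![b, a] (quditGen N n)) ∧
      (SPTLSMObstruction L (fun _ : Fin 2 => N) ![b, a] (quditGen N n) ↔ ¬ (N : ℤ) ∣ n)) ∧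
    (∀ (σ : Type*) [Fintype σ] [DecidableEq σ] [Nonempty σ] (r : ℕ) (N : Fin r → ℕ)
      (a : Fin r → ℤ) (n : Fin r → Fin r → ℤ) (U : Fin r → Matrix.unitaryGroup σ ℂ) (L : ℕ),
      IsExponentialSystem L N a n U →
      (∀ (D : ℕ) (A : Tensor σ D), IsInjective A → IsLeftCanonical A → IsSymmetric L a U A →
        (∃ v : Fin r → Matrix.unitaryGroup (Fin D) ℂ, PushesThrough a U A v) ∧
        (∀ v : Fin r → Matrix.unitaryGroup (Fin D) ℂ, PushesThrough a U A v →
          ∀ j : ℕ, ∃ ω, HasCocycle (bondOp N a v j) ω) ∧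
        ∀ I J, I < J → ∃ k : ℤ,
          SolvesBondEquation (Nat.gcd (N I) (N J)) (a I * a J) (n I J) k ∧
          ∀ v : Fin r → Matrix.unitaryGroup (Fin D) ℂ, PushesThrough a U A v →
            IsBondClass N a v I J (Nat.gcd (N I) (N J)) k) ∧
      ((∃ I J, I < J ∧
          ¬ (Int.gcd (a I * a J - 1) (Nat.gcd (N I) (N J) : ℕ) : ℤ) ∣ n I J) →
        LSMObstruction L a U) ∧
      ((∃ I J, I < J ∧ ∀ k : ℤ,
          SolvesBondEquation (Nat.gcd (N I) (N J)) (a I * a J) (n I J) k →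
            ¬ ((Nat.gcd (N I) (N J) : ℕ) : ℤ) ∣ k) →
        SPTLSMObstruction L N a U) ∧
      (SPTLSMObstruction L N a U ↔
        ∃ I J, I < J ∧ ¬ ((Nat.gcd (N I) (N J) : ℕ) : ℤ) ∣ n I J)) := by
  refine ⟨fun M q n hM => ?_, fun N _ a b n L hL hX hZ => ?_, fun σ _ _ _ r N a n U L h => ?_⟩
  · have : NeZero M := ⟨hM.ne'⟩
    exact ⟨exists_solvesBondEquation_iff, fun hn => ⟨exists_mul_ediv_gcd_modEq_one _,
      fun _ hu => solvesBondEquation_iff_existsUnique hn hu⟩, forall_solvesBondEquation_not_dvd_iff⟩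
  · have h := isExponentialSystem_quditGen hL hX hZ
    have h01 : (0 : Fin 2) < 1 := Fin.zero_lt_one
    refine ⟨fun D A hinj hcan hsym => ⟨h.exists_pushesThrough hinj hcan hsym,
      fun v => h.exists_hasCocycle_bondOp hinj hcan, ?_⟩, fun hn => h.lsmObstruction h01 ?_,
      fun hk => h.sptLSMObstruction h01 ?_, fun hspt => ?_, fun hn => h.sptLSMObstruction h01 ?_⟩
    · simpa [mul_comm b] using h.exists_isBondClass hinj hcan hsym h01
    · simpa [mul_comm b] using hn
    · simpa using forall_solvesBondEquation_not_dvd_iff.1 hk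
    · simpa using h.sptLSMObstruction_iff.1 hspt
    · simpa using hn
  · exact ⟨fun D A hinj hcan hsym => ⟨h.exists_pushesThrough hinj hcan hsym,
      fun v => h.exists_hasCocycle_bondOp hinj hcan,
      fun I J => h.exists_isBondClass hinj hcan hsym⟩,
      fun ⟨I, J, hIJ, hn⟩ => h.lsmObstruction hIJ hn, fun ⟨I, J, hIJ, hk⟩ =>
        h.sptLSMObstruction hIJ (forall_solvesBondEquation_not_dvd_iff.1 hk),
      h.sptLSMObstruction_iff⟩

theorem mainTheorem6 :
    -- the equation `k (q - 1) ≡ n (mod M)`, with `q = ab` and `c = gcd (q - 1, M)`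
    (∀ (M : ℕ) (q n : ℤ), 0 < M →
      ((∃ k : ℤ, SolvesBondEquation M q n k) ↔ (Int.gcd (q - 1) M : ℤ) ∣ n) ∧
      ((Int.gcd (q - 1) M : ℤ) ∣ n →
        (∃ u : ℤ, u * ((q - 1) / (Int.gcd (q - 1) M : ℤ)) ≡ 1
          [ZMOD (M : ℤ) / (Int.gcd (q - 1) M : ℤ)]) ∧
        ∀ u : ℤ, u * ((q - 1) / (Int.gcd (q - 1) M : ℤ)) ≡ 1
          [ZMOD (M : ℤ) / (Int.gcd (q - 1) M : ℤ)] →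
          ∀ k : ℤ, SolvesBondEquation M q n k ↔
            ∃! τ : ℕ, τ < Int.gcd (q - 1) M ∧
              k ≡ n / (Int.gcd (q - 1) M : ℤ) * u + τ * ((M : ℤ) / (Int.gcd (q - 1) M : ℤ))
                [ZMOD (M : ℤ)]) ∧
      (Int.gcd (q - 1) M = 1 →
        ((∀ k : ℤ, SolvesBondEquation M q n k → ¬ (M : ℤ) ∣ k) ↔ ¬ (M : ℤ) ∣ n))) ∧
    -- the qudit chain with the symmetries `⊗ Z ^ (n b ^ j)` and `⊗ X ^ (a ^ j)`
    (∀ (N : ℕ) [NeZero N] (a b n : ℤ) (L : ℕ), 0 < L →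
      IsCoprime a (N : ℤ) → IsCoprime b (N : ℤ) →
      IsPeriodic L (shift N) a →
      IsPeriodic L (clock N ^ n) b →
      (∀ (D : ℕ) (A : Tensor (ZMod N) D),
        IsInjective A → IsLeftCanonical A →
        IsSymmetric L ![b, a] (quditGen N n) A →
        (∃ v : Fin 2 → Matrix.unitaryGroup (Fin D) ℂ,
          PushesThrough ![b, a] (quditGen N n) A v) ∧
        (∀ v : Fin 2 → Matrix.unitaryGroup (Fin D) ℂ,
          PushesThrough ![b, a] (quditGen N n) A v →
          ∀ j : ℕ, ∃ ω, HasCocycle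
            (bondOp (fun _ : Fin 2 => N) ![b, a] v j) ω) ∧
        ∃ k : ℤ, SolvesBondEquation N (a * b) n k ∧
          ∀ v : Fin 2 → Matrix.unitaryGroup (Fin D) ℂ,
            PushesThrough ![b, a] (quditGen N n) A v →
            IsBondClass (fun _ : Fin 2 => N) ![b, a] v 0 1 N k) ∧
      (¬ (Int.gcd (a * b - 1) N : ℤ) ∣ n →
        LSMObstruction L ![b, a] (quditGen N n)) ∧
      ((∀ k : ℤ, SolvesBondEquation N (a * b) n k → ¬ (N : ℤ) ∣ k) →
        SPTLSMObstruction L (fun _ : Fin 2 => N) ![b, a]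
          (quditGen N n)) ∧
      (Int.gcd (a * b - 1) N = 1 →
        (SPTLSMObstruction L (fun _ : Fin 2 => N) ![b, a]
          (quditGen N n) ↔ ¬ (N : ℤ) ∣ n))) ∧
    -- a general finite Abelian group `∏ ℤ/N_I`, acting projectively on each site
    (∀ (σ : Type*) [Fintype σ] [DecidableEq σ] [Nonempty σ] (r : ℕ) (N : Fin r → ℕ)
      (a : Fin r → ℤ) (n : Fin r → Fin r → ℤ) (U : Fin r → Matrix.unitaryGroup σ ℂ) (L : ℕ),
      0 < L → (∀ I, 0 < N I) → (∀ I, IsCoprime (a I) (N I : ℤ)) →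
      (∀ I, EqPhase ((U I ^ N I : Matrix.unitaryGroup σ ℂ) : Matrix σ σ ℂ) 1) →
      (∀ I, IsPeriodic L (U I) (a I)) →
      (∀ I J, I < J → (U I : Matrix σ σ ℂ) * (U J : Matrix σ σ ℂ) =
        (rootPhase (Nat.gcd (N I) (N J)) (n I J) : ℂ) •
          ((U J : Matrix σ σ ℂ) * (U I : Matrix σ σ ℂ))) →
      (∀ (D : ℕ) (A : Tensor σ D),
        IsInjective A → IsLeftCanonical A →
        IsSymmetric L a U A →
        (∃ v : Fin r → Matrix.unitaryGroup (Fin D) ℂ, PushesThrough a U A v) ∧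
        (∀ v : Fin r → Matrix.unitaryGroup (Fin D) ℂ, PushesThrough a U A v →
          ∀ j : ℕ, ∃ ω, HasCocycle (bondOp N a v j) ω) ∧
        ∀ I J, I < J → ∃ k : ℤ,
          SolvesBondEquation (Nat.gcd (N I) (N J)) (a I * a J) (n I J) k ∧
          ∀ v : Fin r → Matrix.unitaryGroup (Fin D) ℂ, PushesThrough a U A v →
            IsBondClass N a v I J (Nat.gcd (N I) (N J)) k) ∧
      ((∃ I J, I < J ∧
          ¬ (Int.gcd (a I * a J - 1) (Nat.gcd (N I) (N J) : ℕ) : ℤ) ∣ n I J) →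
        LSMObstruction L a U) ∧
      ((∃ I J, I < J ∧ ∀ k : ℤ,
          SolvesBondEquation (Nat.gcd (N I) (N J)) (a I * a J) (n I J) k →
            ¬ ((Nat.gcd (N I) (N J) : ℕ) : ℤ) ∣ k) →
        SPTLSMObstruction L N a U) ∧
      ((∀ I J, I < J → Int.gcd (a I * a J - 1) (Nat.gcd (N I) (N J) : ℕ) = 1) →
        (SPTLSMObstruction L N a U ↔
          ∃ I J, I < J ∧ ¬ ((Nat.gcd (N I) (N J) : ℕ) : ℤ) ∣ n I J))) := by
  obtain ⟨hsolutions, hqudit, hsystem⟩ := mainTheorem6_general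
  refine ⟨fun M q n hM => ?_, fun N _ a b n L hL _ _ hX hZ => ?_,
    fun σ _ _ _ r N a n U L hL hN _ hpow hper hcomm => ?_⟩
  · exact (hsolutions M q n hM).imp_right fun h => h.imp_right fun hiff _ => hiff
  · exact (hqudit N a b n L hL hX hZ).imp_right fun h =>
      h.imp_right fun h' => h'.imp_right fun hiff _ => hiff
  · exact (hsystem σ r N a n U L ⟨hL, hN, hpow, hper, hcomm⟩).imp_right fun h =>
      h.imp_right fun h' => h'.imp_right fun hiff _ => hiff
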